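/- Let $\{a_i\}_{i\ge 1}$ be a sequence of positive reals with $\sum_i a_i<1$, and let $P$ be the Borel probability measure on $\ell^2$ obtained by restricting to $\ell^2$ the product over $i$ of the centred Gaussian measures on $\mathbb{R}$ with variance $a_i^2$. Let $m\ge 1$ be an integer, $1\le p<\infty$, and let $O\subset\ell^2$ be a nonempty open set. Let $D_{x_i}$ be the partial derivative in the direction of the $i$-th unit vector $\mathbf e_i$, and $D^k_{x_{i_1}\cdots x_{i_k}}=D_{x_{i_1}}\circ\cdots\circ D_{x_{i_k}}$. A function is F-continuous on $O$ if for every $\mathbf x\in O$ and $l\ge 1$ the map $(s_1,\dots,s_l)\mapsto f(\mathbf x+s_1\mathbf e_1+\cdots+s_l\mathbf e_l)$ is continuous on the set of $(s_1,\dots,s_l)\in\mathbb{R}^l$ with $\mathbf x+s_1\mathbf e_1+\cdots+s_l\mathbf e_l\in O$. Test functions. $C^\infty_{\mathcal F}(O)$ is the set of F-continuous Borel functions $\varphi$ on $O$ all of whose partial derivatives of all orders exist and are bounded, F-continuous and Borel on $O$, such that $\sup_O\sum_{i_1,\dots,i_k}a_{i_1}^2\cdots a_{i_k}^2|D^k_{x_{i_1}\cdots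 x_{i_k}}\varphi|^2<\infty$ for every $k\ge 1$, and such that $E=\{\varphi\ne 0\}$ is bounded and, for some $r>0$, the open $r$-ball around every point of $E$ lies in $O$. Sobolev space. Put $D^*_{x_i}\varphi=-D_{x_i}\varphi+\frac{x_i}{a_i^2}\varphi$. For $f\in L^p(O,P)$, a function $g\in L^p(O,P)$ is the weak derivative $D^k_{x_{i_1}\cdots x_{i_k}}f$ if $$\int_O g\,\varphi\,dP=\int_O f\,(D^*_{x_{i_k}}\circ\cdots\circ D^*_{x_{i_1}})\varphi\,dP\qquad\text{for all }\varphi\in C^\infty_{\mathcal F}(O).$$ $W^{m,p}(O)$ is the set of $f\in L^p(O,P)$ all of whose weak derivatives of orders $1,\dots,m$ exist in $L^p(O,P)$ and for which the following norm is finite: $$\|f\|_{W^{m,p}(O)}=\Big(\int_O|f|^p\,dP+\sum_{k=1}^m\sum_{i_1,\dots,i_k=1}^\infty a_{i_1}^p\cdots a_{i_k}^p\int_O|D^k_{x_{i_1}\cdots x_{i_k}}f|^p\,dP\Big)^{1/p}.$$ The support of $f\in L^p(O,P)$ is $O$ minus the union of all open balls $B\subset O$ with $\int_B|f|^p\,dP=0$.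 Compactly truncated sequences. A sequence $\{X_n\}_{n\ge 1}\subset C^\infty_{\mathcal F}(\ell^2)$ of $[0,1]$-valued functions is called compactly truncated (for the exponent $p$) if 1. for each $n$, the set $\{X_n\neq 0\}$ is contained in a compact subset of $\ell^2$; 2. for each $k\ge 1$ there is a constant $C_k<\infty$ with $\sum_{i_1,\dots,i_k}a_{i_1}^p\cdots a_{i_k}^p|D^k_{x_{i_1}\cdots x_{i_k}}X_n(\mathbf x)|^p\le C_k$ for all $n$ and all $\mathbf x\in\ell^2$; 3. $P$-almost everywhere $X_n\to 1$, and for each $k\ge1$, $P$-almost everywhere $\sum_{i_1,\dots,i_k}a_{i_1}^p\cdots a_{i_k}^p|D^k_{x_{i_1}\cdots x_{i_k}}X_n|^p\to 0$ as $n\to\infty$. Proposition. Compactly truncated sequences exist. For every compactly truncated sequence $\{X_k\}$ and every $f\in W^{m,p}(O)$, $$X_k\cdot f\in W^{m,p}(O)\ \text{ for all }k,\qquad \lim_{k\to\infty}\|X_k\cdot f-f\|_{W^{m,p}(O)}=0.$$ Consequently the functions in $W^{m,p}(O)$ whose support is contained in a compact subset of $\ell^2$ are dense in $W^{m,p}(O)$.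 -/

import Mathlib

open MeasureTheory ProbabilityTheory Filter Topology Set
open scoped ENNReal NNReal

namespace GaussSobolev

/-- The real Hilbert space `ℓ²` of square-summable sequences (coordinates are numbered from `0`). -/
abbrev L2 : Type := lp (fun _ : ℕ => ℝ) 2

noncomputable instance instMeasurableSpaceL2 : MeasurableSpace L2 := borel L2

instance instBorelSpaceL2 : BorelSpace L2 := ⟨rfl⟩

/-- The unit vector `e_i` of `ℓ²`. -/
noncomputable def e (i : ℕ) : L2 := lp.single 2 i (1 : ℝ)

/-- The measure `P` on `ℓ²`: the restriction to `ℓ²` of the product measure on `ℝ^ℕ` whose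
`i`-th factor is the centred Gaussian measure of variance `(a i)²`. -/
noncomputable def P (a : ℕ → ℝ) : Measure L2 :=
  Measure.comap (fun (x : L2) (i : ℕ) => x i)
    (Measure.infinitePi fun i => gaussianReal 0 (Real.toNNReal (a i ^ 2)))

/-- Uniform inclusion of `E` in `V`: some uniform neighbourhood of `E` lies in `V`, and `E` is
bounded. -/
def UniformlyIncluded (E V : Set L2) : Prop :=
  ∃ r R : ℝ, 0 < r ∧ 0 < R ∧ (⋃ x ∈ E, Metric.ball x r) ⊆ V ∧ E ⊆ Metric.ball 0 R

/-- `f` is F-continuous on `O`: it is continuous in finitely many coordinates. -/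
def FContinuousOn (f : L2 → ℝ) (O : Set L2) : Prop :=
  ∀ x ∈ O, ∀ l : ℕ,
    ContinuousOn (fun s : Fin l → ℝ => f (x + ∑ j, s j • e j))
      {s : Fin l → ℝ | x + ∑ j, s j • e j ∈ O}

/-- The partial derivative `D_{x_i} f`. -/
noncomputable def pderiv (i : ℕ) (f : L2 → ℝ) : L2 → ℝ := fun x => lineDeriv ℝ f x (e i)

/-- `iterD [i₁, …, i_k] f = (D_{x_{i₁}} ∘ ⋯ ∘ D_{x_{i_k}}) f`. -/
noncomputable def iterD : List ℕ → (L2 → ℝ) → L2 → ℝ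
  | [], f => f
  | i :: l, f => pderiv i (iterD l f)

/-- `∑_{i₁, …, i_k} a_{i₁}^q ⋯ a_{i_k}^q |D^k_{x_{i₁} ⋯ x_{i_k}} f (x)|^q`, with values in
`[0, ∞]`. -/
noncomputable def derivSum (a : ℕ → ℝ) (q : ℝ) (k : ℕ) (f : L2 → ℝ) (x : L2) : ℝ≥0∞ :=
  ∑' I : Fin k → ℕ,
    (∏ j, ENNReal.ofReal (a (I j)) ^ q) * ‖iterD (List.ofFn I) f x‖ₑ ^ q

/-- The class `C_F^∞(O)`. A function on `O` is given by a function on `ℓ²` whose values outside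
the open set `O` play no role. -/
structure IsCFInfty (O : Set L2) (f : L2 → ℝ) : Prop where
  fcontinuous : FContinuousOn f O
  measurable : Measurable (fun x : O => f x)
  deriv_exists : ∀ (l : List ℕ) (i : ℕ), ∀ x ∈ O, LineDifferentiableAt ℝ (iterD l f) x (e i)
  deriv_bounded : ∀ l : List ℕ, l ≠ [] → ∃ C : ℝ, ∀ x ∈ O, |iterD l f x| ≤ C
  deriv_fcontinuous : ∀ l : List ℕ, l ≠ [] → FContinuousOn (iterD l f) O
  deriv_measurable : ∀ l : List ℕ, l ≠ [] → Measurable (fun x : O => iterD l f x)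

/-- The space of test functions on `O`. -/
structure IsTest (a : ℕ → ℝ) (O : Set L2) (f : L2 → ℝ) : Prop where
  isCFInfty : IsCFInfty O f
  sup_lt_top : ∀ k : ℕ, 1 ≤ k → (⨆ x ∈ O, derivSum a 2 k f x) < ∞
  uniformlyIncluded : UniformlyIncluded {x | x ∈ O ∧ f x ≠ 0} O

/-- `D_{x_i}^* φ = - D_{x_i} φ + (x_i / a_i²) φ`. -/
noncomputable def dualD (a : ℕ → ℝ) (i : ℕ) (φ : L2 → ℝ) : L2 → ℝ :=
  fun x => -pderiv i φ x + x i / a i ^ 2 * φ x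

/-- `iterDual a [i₁, …, i_k] φ = (D_{x_{i_k}}^* ∘ ⋯ ∘ D_{x_{i₁}}^*) φ`. -/
noncomputable def iterDual (a : ℕ → ℝ) : List ℕ → (L2 → ℝ) → L2 → ℝ
  | [], φ => φ
  | i :: l, φ => iterDual a l (dualD a i φ)

/-- `g ∈ L^p(O, P)` is the weak derivative `D^k_{x_{i₁} ⋯ x_{i_k}} f` on `O`,
where `l = [i₁, …, i_k]`. -/
def IsWeakDeriv (a : ℕ → ℝ) (p : ℝ) (O : Set L2) (l : List ℕ) (f g : L2 → ℝ) : Prop :=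
  MemLp g (ENNReal.ofReal p) ((P a).restrict O) ∧
    ∀ φ : L2 → ℝ, IsTest a O φ →
      ∫ x in O, g x * φ x ∂(P a) = ∫ x in O, f x * iterDual a l φ x ∂(P a)

open Classical in
/-- A representative of the weak derivative in `L^p(O, P)`, if it exists. -/
noncomputable def weakDeriv (a : ℕ → ℝ) (p : ℝ) (O : Set L2) (l : List ℕ) (f : L2 → ℝ) :
    L2 → ℝ :=
  if h : ∃ g, IsWeakDeriv a p O l f g then Classical.choose h else 0

/-- `∑_{k=1}^m ∑_{i₁, …, i_k} a_{i₁}^p ⋯ a_{i_k}^p ∫_O |D^k_{x_{i₁} ⋯ x_{i_k}} f|^p dP`. -/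
noncomputable def weakDerivSum (a : ℕ → ℝ) (m : ℕ) (p : ℝ) (O : Set L2) (f : L2 → ℝ) : ℝ≥0∞ :=
  ∑ k ∈ Finset.Icc 1 m, ∑' I : Fin k → ℕ,
    (∏ j, ENNReal.ofReal (a (I j)) ^ p) *
      ∫⁻ x in O, ‖weakDeriv a p O (List.ofFn I) f x‖ₑ ^ p ∂(P a)

/-- Membership in the Sobolev space `W^{m,p}(O)`. -/
structure MemW (a : ℕ → ℝ) (m : ℕ) (p : ℝ) (O : Set L2) (f : L2 → ℝ) : Prop where
  memLp : MemLp f (ENNReal.ofReal p) ((P a).restrict O)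
  exists_weakDeriv : ∀ l : List ℕ, 1 ≤ l.length → l.length ≤ m → ∃ g, IsWeakDeriv a p O l f g
  sum_lt_top : weakDerivSum a m p O f < ∞

/-- The norm of `W^{m,p}(O)`, with values in `[0, ∞]`. -/
noncomputable def normW (a : ℕ → ℝ) (m : ℕ) (p : ℝ) (O : Set L2) (f : L2 → ℝ) : ℝ≥0∞ :=
  (∫⁻ x in O, ‖f x‖ₑ ^ p ∂(P a) + weakDerivSum a m p O f) ^ (1 / p)

/-- The support of `f ∈ L^p(O, P)`: what is left of `O` after removing all open balls contained in
`O` on which the integral of `|f|^p` vanishes. -/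
def supp (a : ℕ → ℝ) (p : ℝ) (O : Set L2) (f : L2 → ℝ) : Set L2 :=
  O \ ⋃₀ {B | ∃ (x : L2) (r : ℝ), 0 < r ∧ B = Metric.ball x r ∧ B ⊆ O ∧
    ∫⁻ y in B, ‖f y‖ₑ ^ p ∂(P a) = 0}

/-- Compactly truncated sequences for the exponent `p`. -/
structure IsCompactlyTruncated (a : ℕ → ℝ) (p : ℝ) (X : ℕ → L2 → ℝ) : Prop where
  isTest : ∀ n, IsTest a univ (X n)
  mem_Icc : ∀ n x, X n x ∈ Icc (0 : ℝ) 1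
  compact_support : ∀ n, ∃ K : Set L2, IsCompact K ∧ {x | X n x ≠ 0} ⊆ K
  deriv_bound : ∀ k : ℕ, 1 ≤ k → ∃ C : ℝ≥0, ∀ (n : ℕ) (x : L2), derivSum a p k (X n) x ≤ C
  tendsto_one : ∀ᵐ x ∂(P a), Tendsto (fun n => X n x) atTop (𝓝 1)
  tendsto_deriv : ∀ k : ℕ, 1 ≤ k →
    ∀ᵐ x ∂(P a), Tendsto (fun n => derivSum a p k (X n) x) atTop (𝓝 0)

end GaussSobolev

/-!
The proof uses no integration by parts: the relation between weak derivatives and test functions is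
purely algebraic, and all the analysis sits in the construction of test functions.

*Multiplication.* Pointwise, `Y · D_i^* φ = D_i^* (Y φ) + (D_i Y) φ`. Iterating this (`mul_iterDual`)
and integrating against `f` shows that `Y f` has the weak derivatives given by the Leibniz rule
(`isWeakDeriv_mul`), as soon as the functions `(D_S Y) φ` are again test functions. For this one needs
that test functions are stable under `D_i`, `D_i^*` and multiplication by `Multiplier`s. Test
functions are automatically bounded (`exists_abs_le_of_uniformlyIncluded`), so that the class may be
described by square bounds of all orders, zero included (`isTest_iff`), and these bounds are stable
under products by the `ℓ^q` Leibniz estimate `lsum_leibniz_le`.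

*Uniqueness.* The norm is computed with an arbitrarily chosen weak derivative, so uniqueness almost
everywhere is needed (`IsWeakDeriv.ae_eq`). Products of a local bump with the functions
`cos (⟨ξ, x⟩ + θ)` are test functions, so the Fourier transform of `g · bump` vanishes whenever `g` is
orthogonal to all test functions, hence `g = 0`.

*Existence of truncations.* With `h` a smooth cutoff, take `X_n(x) = h((n + 1)⁻¹ ∑ c_i x_i²)` where
`c_i → ∞` but `∑ a_i c_i < ∞` (`exists_weights`). The sets `{∑ c_i x_i² ≤ R}` are relatively compact,
the form is finite almost surely because `∑ c_i a_i² < ∞`, and all derivatives of order `k` along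
`e_{i₁}, …, e_{i_k}` are bounded by a constant times `c_{i₁} ⋯ c_{i_k}`, uniformly in `n`
(`exists_iterD_bump_le`). The local bumps are of the same kind, with constant weights.

*Convergence.* Applied to `Y = X_n - 1`, the Leibniz estimate bounds the `p`-th power of the norm of
`X_n f - f` by `∫ (∑_k ∑_I a_I^p |D_I Y|^p) · (∑_k ∑_I a_I^p |D_I f|^p) dP`
(`exists_sobolev_mul_bound`), where the first factor is bounded and tends to zero almost everywhere,
and the second one is integrable. Dominated convergence concludes.
-/

namespace GaussSobolev

/-! ### Leibniz splittings and sums over multi-indices -/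

/-- All ways of splitting a list into a sublist and its complementary sublist, both in the
original order; these index the terms of the Leibniz rule. -/
def splits : List ℕ → List (List ℕ × List ℕ)
  | [] => [([], [])]
  | i :: l => (splits l).map (fun s => (i :: s.1, s.2)) ++ (splits l).map (fun s => (s.1, i :: s.2))

lemma length_splits (l : List ℕ) : (splits l).length = 2 ^ l.length := by
  induction l with
  | nil => simp [splits]
  | cons i l ih => simp [splits, ih, pow_succ, mul_two]

lemma length_add_of_mem_splits {l : List ℕ} {s : List ℕ × List ℕ} (hs : s ∈ splits l) :
    s.1.length + s.2.length = l.length := by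
  induction l generalizing s with
  | nil => simp only [splits, List.mem_singleton] at hs; simp [hs]
  | cons i l ih =>
    simp only [splits, List.mem_append, List.mem_map] at hs
    rcases hs with ⟨t, ht, rfl⟩ | ⟨t, ht, rfl⟩ <;> have := ih ht <;> simp <;> omega

/-- The product of the weights `(a i) ^ q` over the entries of a multi-index. -/
noncomputable def lwt (a : ℕ → ℝ) (q : ℝ) (l : List ℕ) : ℝ≥0∞ :=
  (l.map fun i => ENNReal.ofReal (a i) ^ q).prod

lemma lwt_cons (a : ℕ → ℝ) (q : ℝ) (i : ℕ) (l : List ℕ) :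
    lwt a q (i :: l) = ENNReal.ofReal (a i) ^ q * lwt a q l := by simp [lwt]

lemma lwt_append (a : ℕ → ℝ) (q : ℝ) (l l' : List ℕ) :
    lwt a q (l ++ l') = lwt a q l * lwt a q l' := by simp [lwt]

lemma lwt_ofFn (a : ℕ → ℝ) (q : ℝ) {k : ℕ} (I : Fin k → ℕ) :
    lwt a q (List.ofFn I) = ∏ j, ENNReal.ofReal (a (I j)) ^ q := by
  simp [lwt, List.map_ofFn, List.prod_ofFn]

lemma lwt_ne_top (a : ℕ → ℝ) {q : ℝ} (hq : 0 ≤ q) (l : List ℕ) : lwt a q l ≠ ∞ := by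
  induction l with
  | nil => simp [lwt]
  | cons i l ih =>
    rw [lwt_cons]
    exact ENNReal.mul_ne_top (ENNReal.rpow_ne_top_of_nonneg hq ENNReal.ofReal_ne_top) ih

lemma lwt_ne_zero {a : ℕ → ℝ} (ha : ∀ i, 0 < a i) (q : ℝ) (l : List ℕ) : lwt a q l ≠ 0 := by
  induction l with
  | nil => simp [lwt]
  | cons i l ih =>
    rw [lwt_cons]
    exact mul_ne_zero (ENNReal.rpow_pos (by simpa using ha i) ENNReal.ofReal_ne_top).ne' ih

lemma lwt_mul_of_mem_splits (a : ℕ → ℝ) (q : ℝ) {l : List ℕ} {s : List ℕ × List ℕ}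
    (hs : s ∈ splits l) : lwt a q s.1 * lwt a q s.2 = lwt a q l := by
  induction l generalizing s with
  | nil => simp only [splits, List.mem_singleton] at hs; simp [hs, lwt]
  | cons i l ih =>
    simp only [splits, List.mem_append, List.mem_map] at hs
    rcases hs with ⟨t, ht, rfl⟩ | ⟨t, ht, rfl⟩ <;> simp only [lwt_cons, ← ih ht] <;> ring

/-- The sum of `A` over all multi-indices of length `k`. -/
noncomputable def lsum (k : ℕ) (A : List ℕ → ℝ≥0∞) : ℝ≥0∞ := ∑' I : Fin k → ℕ, A (List.ofFn I)

lemma lsum_zero (A : List ℕ → ℝ≥0∞) : lsum 0 A = A [] := by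
  simp [lsum, tsum_fintype]

lemma lsum_succ (k : ℕ) (A : List ℕ → ℝ≥0∞) :
    lsum (k + 1) A = ∑' i, lsum k fun l => A (i :: l) := by
  unfold lsum
  rw [← (Fin.consEquiv fun _ : Fin (k + 1) => ℕ).tsum_eq, ENNReal.tsum_prod']
  simp [Fin.consEquiv, List.ofFn_succ]

lemma lsum_mono {k : ℕ} {A B : List ℕ → ℝ≥0∞} (h : ∀ l, l.length = k → A l ≤ B l) :
    lsum k A ≤ lsum k B :=
  ENNReal.tsum_le_tsum fun I => h _ (by simp)

lemma lsum_congr {k : ℕ} {A B : List ℕ → ℝ≥0∞} (h : ∀ l, l.length = k → A l = B l) :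
    lsum k A = lsum k B :=
  tsum_congr fun I => h _ (by simp)

lemma lsum_const_mul (k : ℕ) (C : ℝ≥0∞) (A : List ℕ → ℝ≥0∞) :
    lsum k (fun l => C * A l) = C * lsum k A := ENNReal.tsum_mul_left

lemma le_lsum (A : List ℕ → ℝ≥0∞) (l : List ℕ) : A l ≤ lsum l.length A := by
  have := ENNReal.le_tsum (f := fun I : Fin l.length → ℕ => A (List.ofFn I)) l.get
  simpa [lsum, List.ofFn_get] using this

/-- The multi-indices with a prescribed last entry form a part of all multi-indices. -/
lemma lsum_append_singleton_le (k : ℕ) (A : List ℕ → ℝ≥0∞) (i : ℕ) :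
    lsum k (fun l => A (l ++ [i])) ≤ lsum (k + 1) A := by
  induction k generalizing A with
  | zero =>
    rw [lsum_zero]
    exact le_lsum A [i]
  | succ k ih =>
    rw [lsum_succ, lsum_succ]
    exact ENNReal.tsum_le_tsum fun j => ih fun l => A (j :: l)

lemma lsum_lwt (a : ℕ → ℝ) (q : ℝ) (k : ℕ) :
    lsum k (lwt a q) = (∑' i, ENNReal.ofReal (a i) ^ q) ^ k := by
  induction k with
  | zero => simp [lsum_zero, lwt]
  | succ k ih =>
    simp only [lsum_succ, lwt_cons, lsum_const_mul, ih, ENNReal.tsum_mul_right]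
    rw [pow_succ']

/-- Sums of Leibniz type are controlled by the product of the sums of the factors. -/
lemma lsum_splits_le (k : ℕ) (A B : List ℕ → ℝ≥0∞) :
    lsum k (fun l => ((splits l).map fun s => A s.1 * B s.2).sum) ≤
      2 ^ k * ((∑ u ∈ Finset.range (k + 1), lsum u A) *
        ∑ v ∈ Finset.range (k + 1), lsum v B) := by
  induction k generalizing A B with
  | zero => simp [lsum_zero, splits]
  | succ k ih =>
    have shift : ∀ A : List ℕ → ℝ≥0∞,
        ∑' i, ∑ u ∈ Finset.range (k + 1), lsum u (fun l => A (i :: l)) ≤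
          ∑ u ∈ Finset.range (k + 1 + 1), lsum u A := by
      intro A
      rw [Summable.tsum_finsetSum fun _ _ => ENNReal.summable, Finset.sum_range_succ' _ (k + 1)]
      simp only [← lsum_succ]
      exact le_self_add
    have grow : ∀ A : List ℕ → ℝ≥0∞, ∑ u ∈ Finset.range (k + 1), lsum u A ≤
        ∑ u ∈ Finset.range (k + 1 + 1), lsum u A := fun A =>
      Finset.sum_le_sum_of_subset (Finset.range_mono (Nat.le_succ _))
    rw [lsum_succ]
    have key : ∀ i, lsum k (fun l => ((splits (i :: l)).map fun s => A s.1 * B s.2).sum) ≤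
        2 ^ k * ((∑ u ∈ Finset.range (k + 1), lsum u (fun l => A (i :: l))) *
          ∑ v ∈ Finset.range (k + 1), lsum v B) +
        2 ^ k * ((∑ u ∈ Finset.range (k + 1), lsum u A) *
          ∑ v ∈ Finset.range (k + 1), lsum v (fun l => B (i :: l))) := by
      intro i
      refine le_trans (le_of_eq ?_)
        (add_le_add (ih (fun l => A (i :: l)) B) (ih A fun l => B (i :: l)))
      rw [lsum, lsum, lsum, ← ENNReal.tsum_add]
      simp [splits, List.map_map, Function.comp_def]
    refine (ENNReal.tsum_le_tsum key).trans ?_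
    rw [ENNReal.tsum_add, ENNReal.tsum_mul_left, ENNReal.tsum_mul_left, ENNReal.tsum_mul_right,
      ENNReal.tsum_mul_left, pow_succ, mul_assoc, two_mul, ← mul_add]
    exact mul_le_mul_right (add_le_add (mul_le_mul' (shift A) (grow B))
      (mul_le_mul' (grow A) (shift B))) _

/-- A crude form of the power mean inequality, sufficient for finiteness statements. -/
lemma list_sum_rpow_le {q : ℝ} (hq : 0 < q) (L : List ℝ≥0∞) :
    L.sum ^ q ≤ (L.length : ℝ≥0∞) ^ q * (L.map fun t => t ^ q).sum := by
  have h : ∀ t ∈ L, t ≤ ((L.map fun t => t ^ q).sum) ^ (1 / q) := by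
    intro t ht
    rw [one_div, ENNReal.le_rpow_inv_iff hq]
    exact List.single_le_sum (fun _ _ => zero_le) _ (List.mem_map_of_mem ht)
  have h2 := List.sum_le_card_nsmul L _ h
  calc L.sum ^ q ≤ (L.length • ((L.map fun t => t ^ q).sum) ^ (1 / q)) ^ q := by gcongr
    _ = _ := by
      rw [nsmul_eq_mul, ENNReal.mul_rpow_of_nonneg _ _ hq.le, ← ENNReal.rpow_mul,
        one_div_mul_cancel hq.ne', ENNReal.rpow_one]

lemma enorm_list_sum_le (L : List ℝ) : ‖L.sum‖ₑ ≤ (L.map fun t => ‖t‖ₑ).sum := by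
  induction L with
  | nil => simp
  | cons t L ih =>
    simp only [List.sum_cons, List.map_cons]
    exact (enorm_add_le _ _).trans (by gcongr)

/-- The `ℓ^q` form of the Leibniz estimate, for the weights `a`. -/
lemma lsum_leibniz_le (a : ℕ → ℝ) {q : ℝ} (hq : 0 < q) (k : ℕ) :
    ∃ C : ℝ≥0, ∀ F G H : List ℕ → ℝ,
      (∀ l, l.length = k → F l = ((splits l).map fun s => G s.1 * H s.2).sum) →
      lsum k (fun l => lwt a q l * ‖F l‖ₑ ^ q) ≤
        C * ((∑ u ∈ Finset.range (k + 1), lsum u fun l => lwt a q l * ‖G l‖ₑ ^ q) *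
          ∑ v ∈ Finset.range (k + 1), lsum v fun l => lwt a q l * ‖H l‖ₑ ^ q) := by
  refine ⟨((2 ^ k : ℕ) : ℝ≥0) ^ q * 2 ^ k, fun F G H hF => ?_⟩
  have : ∀ l, l.length = k → lwt a q l * ‖F l‖ₑ ^ q ≤ ((2 ^ k : ℕ) : ℝ≥0∞) ^ q *
      ((splits l).map fun s => (lwt a q s.1 * ‖G s.1‖ₑ ^ q) *
        (lwt a q s.2 * ‖H s.2‖ₑ ^ q)).sum := by
    intro l hl
    rw [hF l hl]
    have h1 := ENNReal.rpow_le_rpow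
      (enorm_list_sum_le ((splits l).map fun s => G s.1 * H s.2)) hq.le
    have h2 := h1.trans (list_sum_rpow_le hq _)
    rw [List.length_map, List.length_map, length_splits, hl, List.map_map, List.map_map] at h2
    refine (mul_le_mul_right h2 _).trans (le_of_eq ?_)
    rw [mul_left_comm, ← List.sum_map_mul_left]
    congr 2
    refine List.map_congr_left fun s hs => ?_
    simp only [Function.comp, enorm_mul, ENNReal.mul_rpow_of_nonneg _ _ hq.le,
      ← lwt_mul_of_mem_splits a q hs]
    ring
  refine (lsum_mono this).trans ?_
  rw [lsum_const_mul]
  refine (mul_le_mul_right (lsum_splits_le k (fun l => lwt a q l * ‖G l‖ₑ ^ q)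
    fun l => lwt a q l * ‖H l‖ₑ ^ q) _).trans (le_of_eq ?_)
  rw [ENNReal.coe_mul, ENNReal.coe_rpow_of_nonneg _ hq.le]
  push_cast
  ring

lemma derivSum_eq (a : ℕ → ℝ) (q : ℝ) (k : ℕ) (f : L2 → ℝ) (x : L2) :
    derivSum a q k f x = lsum k fun l => lwt a q l * ‖iterD l f x‖ₑ ^ q := by
  simp only [derivSum, lsum, lwt_ofFn]

/-! ### Calculus of iterated partial derivatives -/

lemma hasLineDerivAt_list_sum {ι : Type*} {x v : L2} (L : List ι) (F : ι → L2 → ℝ) (F' : ι → ℝ)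
    (h : ∀ s ∈ L, HasLineDerivAt ℝ (F s) (F' s) x v) :
    HasLineDerivAt ℝ (fun y => (L.map fun s => F s y).sum) (L.map F').sum x v := by
  induction L with
  | nil => exact hasDerivAt_const (0 : ℝ) (0 : ℝ)
  | cons s L ih =>
    simp only [List.map_cons, List.sum_cons]
    exact HasDerivAt.add (h s (by simp)) (ih fun t ht => h t (by simp [ht]))

lemma hasLineDerivAt_mul {f g : L2 → ℝ} {f' g' : ℝ} {x v : L2}
    (hf : HasLineDerivAt ℝ f f' x v) (hg : HasLineDerivAt ℝ g g' x v) :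
    HasLineDerivAt ℝ (fun y => f y * g y) (f' * g x + f x * g') x v := by
  have := HasDerivAt.fun_mul hf hg
  simp only [zero_smul, add_zero] at this
  exact this

lemma iterD_append (l l' : List ℕ) (f : L2 → ℝ) : iterD (l ++ l') f = iterD l (iterD l' f) := by
  induction l with
  | nil => rfl
  | cons i l ih => simp [iterD, ih]

lemma iterD_congr {O : Set L2} (hO : IsOpen O) {f g : L2 → ℝ} (h : EqOn f g O) (l : List ℕ) :
    EqOn (iterD l f) (iterD l g) O := by
  induction l with
  | nil => exact h
  | cons i l ih =>
    intro x hx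
    exact (ih.eventuallyEq_of_mem (hO.mem_nhds hx)).lineDeriv_eq

lemma iterD_zero (l : List ℕ) : iterD l (fun _ => 0) = fun _ => 0 := by
  induction l with
  | nil => rfl
  | cons i l ih =>
    simp only [iterD, ih]
    ext x
    simp [pderiv, lineDeriv]

lemma iterD_const {l : List ℕ} (hl : l ≠ []) (r : ℝ) : iterD l (fun _ => r) = fun _ => 0 := by
  obtain ⟨l', i, rfl⟩ := List.eq_nil_or_concat' l |>.resolve_left hl
  rw [iterD_append]
  have : iterD [i] (fun _ => r) = fun _ => 0 := by
    ext x
    simp [iterD, pderiv, lineDeriv]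
  rw [this, iterD_zero]

lemma FContinuousOn.congr {f g : L2 → ℝ} {O : Set L2} (hf : FContinuousOn f O) (h : EqOn g f O) :
    FContinuousOn g O := fun x hx l => (hf x hx l).congr fun _ hs => h hs

lemma FContinuousOn.mul {f g : L2 → ℝ} {O : Set L2} (hf : FContinuousOn f O)
    (hg : FContinuousOn g O) : FContinuousOn (fun x => f x * g x) O :=
  fun x hx l => (hf x hx l).mul (hg x hx l)

lemma FContinuousOn.add {f g : L2 → ℝ} {O : Set L2} (hf : FContinuousOn f O)
    (hg : FContinuousOn g O) : FContinuousOn (fun x => f x + g x) O :=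
  fun x hx l => (hf x hx l).add (hg x hx l)

lemma fContinuousOn_of_continuous {f : L2 → ℝ} (hf : Continuous f) (O : Set L2) :
    FContinuousOn f O := fun x _ l =>
  (hf.comp (by fun_prop : Continuous fun s : Fin l → ℝ => x + ∑ j, s j • e j)).continuousOn

lemma FContinuousOn.mono {f : L2 → ℝ} {O U : Set L2} (hf : FContinuousOn f U) (h : O ⊆ U) :
    FContinuousOn f O := fun x hx l => (hf x (h hx) l).mono fun _ hs => h hs

lemma FContinuousOn.list_sum {ι : Type*} {O : Set L2} (L : List ι) (F : ι → L2 → ℝ)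
    (h : ∀ s ∈ L, FContinuousOn (F s) O) :
    FContinuousOn (fun y => (L.map fun s => F s y).sum) O := by
  induction L with
  | nil => simpa using fContinuousOn_of_continuous continuous_const O
  | cons s L ih =>
    simp only [List.map_cons, List.sum_cons]
    exact (h s (by simp)).add (ih fun t ht => h t (by simp [ht]))

lemma measurable_list_map_sum {α ι : Type*} [MeasurableSpace α] (L : List ι) (F : ι → α → ℝ)
    (h : ∀ s ∈ L, Measurable (F s)) : Measurable fun y => (L.map fun s => F s y).sum := by
  induction L with
  | nil => simp
  | cons s L ih =>
    simp only [List.map_cons, List.sum_cons]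
    exact (h s (by simp)).add (ih fun t ht => h t (by simp [ht]))

/-- All iterated partial derivatives of `f`, `f` itself included, are partially differentiable,
F-continuous and Borel on `O`. -/
structure FSmooth (O : Set L2) (f : L2 → ℝ) : Prop where
  diff : ∀ (l : List ℕ) (i : ℕ), ∀ x ∈ O, LineDifferentiableAt ℝ (iterD l f) x (e i)
  fcont : ∀ l : List ℕ, FContinuousOn (iterD l f) O
  meas : ∀ l : List ℕ, Measurable fun x : O => iterD l f x

lemma FSmooth.hasLineDerivAt {O : Set L2} {f : L2 → ℝ} (hf : FSmooth O f) (l : List ℕ) (i : ℕ)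
    {x : L2} (hx : x ∈ O) : HasLineDerivAt ℝ (iterD l f) (iterD (i :: l) f x) x (e i) :=
  (hf.diff l i x hx).hasLineDerivAt

lemma FSmooth.iter {O : Set L2} {f : L2 → ℝ} (hf : FSmooth O f) (l : List ℕ) :
    FSmooth O (iterD l f) where
  diff l' := by rw [← iterD_append]; exact hf.diff _
  fcont l' := by rw [← iterD_append]; exact hf.fcont _
  meas l' := by rw [← iterD_append]; exact hf.meas _

lemma FSmooth.mono {O U : Set L2} {f : L2 → ℝ} (hf : FSmooth U f) (h : O ⊆ U) : FSmooth O f where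
  diff l i x hx := hf.diff l i x (h hx)
  fcont l := (hf.fcont l).mono h
  meas l := (hf.meas l).comp (measurable_inclusion h)

/-- A family of functions that satisfies the recursion of iterated partial derivatives, starting
from `f`, consists of the iterated partial derivatives of `f`. -/
lemma FSmooth.of_family {O : Set L2} (hO : IsOpen O) {f : L2 → ℝ} (G : List ℕ → L2 → ℝ)
    (h0 : EqOn f (G []) O)
    (hd : ∀ l i, ∀ x ∈ O, HasLineDerivAt ℝ (G l) (G (i :: l) x) x (e i))
    (hc : ∀ l, FContinuousOn (G l) O) (hm : ∀ l, Measurable fun x : O => G l x) :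
    FSmooth O f ∧ ∀ l, EqOn (iterD l f) (G l) O := by
  have key : ∀ l, EqOn (iterD l f) (G l) O := by
    intro l
    induction l with
    | nil => exact h0
    | cons i l ih =>
      intro x hx
      have := (ih.eventuallyEq_of_mem (hO.mem_nhds hx)).lineDeriv_eq (𝕜 := ℝ) (v := e i)
      exact this.trans (hd l i x hx).lineDeriv
  refine ⟨⟨fun l i x hx => ?_, fun l => (hc l).congr (key l), fun l => ?_⟩, key⟩
  · exact (hd l i x hx).lineDifferentiableAt.congr_of_eventuallyEq
      ((key l).eventuallyEq_of_mem (hO.mem_nhds hx))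
  · have : (fun x : O => iterD l f x) = fun x : O => G l x := by
      ext x; exact key l x.2
    rw [this]; exact hm l

lemma fsmooth_const (O : Set L2) (r : ℝ) : FSmooth O fun _ => r := by
  have : ∀ l, iterD l (fun _ => r) = fun _ => if l = [] then r else 0 := by
    intro l
    by_cases hl : l = []
    · simp [hl, iterD]
    · simp [hl, iterD_const hl]
  refine ⟨fun l i x _ => ?_, fun l => ?_, fun l => ?_⟩ <;> rw [this]
  · exact (differentiableAt_const _).lineDifferentiableAt
  · exact fContinuousOn_of_continuous continuous_const O
  · exact measurable_const

/-- The Leibniz rule. -/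
lemma FSmooth.mul_and_iterD_mul {O : Set L2} (hO : IsOpen O) {f g : L2 → ℝ} (hf : FSmooth O f)
    (hg : FSmooth O g) : FSmooth O (fun x => f x * g x) ∧
      ∀ l, EqOn (iterD l fun x => f x * g x) (fun x => ((splits l).map fun s =>
        iterD s.1 f x * iterD s.2 g x).sum) O := by
  refine FSmooth.of_family hO (fun l x => ((splits l).map fun s =>
        iterD s.1 f x * iterD s.2 g x).sum) ?_ ?_ ?_ ?_
  · intro x _; simp [splits, iterD]
  · intro l i x hx
    have := hasLineDerivAt_list_sum (x := x) (v := e i) (splits l)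
      (fun s x => iterD s.1 f x * iterD s.2 g x) _
      fun s _ => hasLineDerivAt_mul (hf.hasLineDerivAt s.1 i hx) (hg.hasLineDerivAt s.2 i hx)
    rw [List.sum_map_add] at this
    simpa only [splits, List.map_append, List.map_map, List.sum_append, Function.comp_def] using this
  · exact fun l => FContinuousOn.list_sum _ _ fun s _ => (hf.fcont s.1).mul (hg.fcont s.2)
  · exact fun l => measurable_list_map_sum (splits l)
      (fun s (x : O) => iterD s.1 f x * iterD s.2 g x)
      fun s _ => (hf.meas s.1).mul (hg.meas s.2)

lemma FSmooth.mul {O : Set L2} (hO : IsOpen O) {f g : L2 → ℝ} (hf : FSmooth O f)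
    (hg : FSmooth O g) : FSmooth O (fun x => f x * g x) := (hf.mul_and_iterD_mul hO hg).1

lemma FSmooth.iterD_mul {O : Set L2} (hO : IsOpen O) {f g : L2 → ℝ} (hf : FSmooth O f)
    (hg : FSmooth O g) (l : List ℕ) {x : L2} (hx : x ∈ O) :
    iterD l (fun x => f x * g x) x = ((splits l).map fun s =>
        iterD s.1 f x * iterD s.2 g x).sum :=
  (hf.mul_and_iterD_mul hO hg).2 l hx

lemma FSmooth.add_and_iterD_add {O : Set L2} (hO : IsOpen O) {f g : L2 → ℝ} (hf : FSmooth O f)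
    (hg : FSmooth O g) : FSmooth O (fun x => f x + g x) ∧
      ∀ l, EqOn (iterD l fun x => f x + g x) (fun x =>
        iterD l f x + iterD l g x) O := by
  refine FSmooth.of_family hO (fun l x => iterD l f x + iterD l g x)
    (fun x _ => rfl) ?_ ?_ ?_
  · exact fun l i x hx => HasDerivAt.add (hf.hasLineDerivAt l i hx) (hg.hasLineDerivAt l i hx)
  · exact fun l => (hf.fcont l).add (hg.fcont l)
  · exact fun l => (hf.meas l).add (hg.meas l)

/-! ### Bounds on derivative sums and test functions -/

lemma e_apply (i j : ℕ) : (e i : ℕ → ℝ) j = if j = i then 1 else 0 := by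
  by_cases h : j = i
  · subst h; simp [e]
  · simp [e, h]

lemma norm_e (i : ℕ) : ‖e i‖ = 1 := by
  simp [e, lp.norm_single (E := fun _ : ℕ => ℝ) (p := 2) (by norm_num) i (1 : ℝ)]

/-- A pointwise bound on a derivative sum bounds each single derivative. -/
lemma exists_iterD_le {a : ℕ → ℝ} (ha : ∀ i, 0 < a i) {q : ℝ} (hq : 0 < q) {S : Set L2}
    {f : L2 → ℝ} {l : List ℕ} {C : ℝ≥0} (h : ∀ x ∈ S, derivSum a q l.length f x ≤ C) :
    ∃ D : ℝ, 0 ≤ D ∧ ∀ x ∈ S, |iterD l f x| ≤ D := by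
  refine ⟨(((C : ℝ≥0∞) / lwt a q l) ^ (1 / q)).toReal, ENNReal.toReal_nonneg, fun x hx => ?_⟩
  have h1 : lwt a q l * ‖iterD l f x‖ₑ ^ q ≤ C := by
    refine le_trans ?_ (h x hx)
    rw [derivSum_eq]
    exact le_lsum (fun l => lwt a q l * ‖iterD l f x‖ₑ ^ q) l
  have h2 : ‖iterD l f x‖ₑ ≤ ((C : ℝ≥0∞) / lwt a q l) ^ (1 / q) := by
    rw [one_div, ENNReal.le_rpow_inv_iff hq, ENNReal.le_div_iff_mul_le
      (Or.inl (lwt_ne_zero ha q l)) (Or.inl (lwt_ne_top a hq.le l)), mul_comm]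
    exact h1
  have h3 : ((C : ℝ≥0∞) / lwt a q l) ^ (1 / q) ≠ ∞ :=
    ENNReal.rpow_ne_top_of_nonneg (by positivity)
      (ENNReal.div_ne_top ENNReal.coe_ne_top (lwt_ne_zero ha q l))
  rw [← Real.norm_eq_abs, ← toReal_enorm]
  exact ENNReal.toReal_mono h3 h2

/-- If the derivatives of order `k` are dominated by products of weights, then the derivative
sum is dominated by a power of a single series. -/
lemma derivSum_le_of_le {a w : ℕ → ℝ} (ha : ∀ i, 0 < a i) (hw : ∀ i, 0 ≤ w i) {q : ℝ} (hq : 0 < q)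
    {k : ℕ} {f : L2 → ℝ} {x : L2} {K : ℝ}
    (h : ∀ l : List ℕ, l.length = k → |iterD l f x| ≤ K * (l.map w).prod) :
    derivSum a q k f x ≤
      ENNReal.ofReal K ^ q * (∑' i, ENNReal.ofReal (a i * w i) ^ q) ^ k := by
  rw [derivSum_eq, ← lsum_lwt (fun i => a i * w i) q, ← lsum_const_mul]
  refine lsum_mono fun l hl => ?_
  have h1 : ‖iterD l f x‖ₑ ≤ ENNReal.ofReal K * ENNReal.ofReal (l.map w).prod := by
    rw [← ENNReal.ofReal_mul' (List.prod_nonneg (by simp [hw])), ← ofReal_norm]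
    exact ENNReal.ofReal_le_ofReal (h l hl)
  have h2 : lwt (fun i => a i * w i) q l = lwt a q l * ENNReal.ofReal (l.map w).prod ^ q := by
    clear h h1 hl
    induction l with
    | nil => simp [lwt]
    | cons i l ih =>
      simp only [lwt_cons, ih, List.map_cons, List.prod_cons]
      rw [ENNReal.ofReal_mul (ha i).le, ENNReal.ofReal_mul (hw i),
        ENNReal.mul_rpow_of_nonneg _ _ hq.le, ENNReal.mul_rpow_of_nonneg _ _ hq.le]
      ring
  calc _ ≤ lwt a q l * (ENNReal.ofReal K * ENNReal.ofReal (l.map w).prod) ^ q := by gcongr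
    _ = _ := by rw [h2, ENNReal.mul_rpow_of_nonneg _ _ hq.le]; ring

lemma tsum_ofReal_rpow_lt_top {b : ℕ → ℝ} (hb : ∀ i, 0 ≤ b i) (hs : Summable b) {q : ℝ}
    (hq : 1 ≤ q) : ∑' i, ENNReal.ofReal (b i) ^ q < ∞ := by
  have h0 : ∑' i, ENNReal.ofReal (b i) ≠ ∞ := by
    rw [← ENNReal.ofReal_tsum_of_nonneg hb hs]; exact ENNReal.ofReal_ne_top
  have h1 : ∀ i, ENNReal.ofReal (b i) ^ q ≤
      (∑' i, ENNReal.ofReal (b i)) ^ (q - 1) * ENNReal.ofReal (b i) := by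
    intro i
    have h2 : ENNReal.ofReal (b i) ≤ ∑' i, ENNReal.ofReal (b i) :=
      ENNReal.le_tsum (f := fun i => ENNReal.ofReal (b i)) i
    have h3 : q = (q - 1) + 1 := by ring
    conv_lhs => rw [h3, ENNReal.rpow_add_of_nonneg _ _ (by linarith) zero_le_one,
      ENNReal.rpow_one]
    exact mul_le_mul_left (ENNReal.rpow_le_rpow h2 (by linarith)) _
  refine (ENNReal.tsum_le_tsum h1).trans_lt ?_
  rw [ENNReal.tsum_mul_left]
  exact ENNReal.mul_lt_top (ENNReal.rpow_lt_top_of_nonneg (by linarith) h0) h0.lt_top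

/-- Uniform square bounds: for every order `k`, order zero included, the weighted sum of squared
derivatives is bounded on `S`. -/
def QB (a : ℕ → ℝ) (S : Set L2) (f : L2 → ℝ) : Prop :=
  ∀ k, ∃ C : ℝ≥0, ∀ x ∈ S, derivSum a 2 k f x ≤ C

lemma QB.mono {a : ℕ → ℝ} {S T : Set L2} {f : L2 → ℝ} (h : QB a T f) (hST : S ⊆ T) : QB a S f :=
  fun k => (h k).imp fun _ hC x hx => hC x (hST hx)

/-- Square bounds from bounds by products of weights `w` with `∑ (a_i w_i)² < ∞`. -/
lemma qb_of_le {a w : ℕ → ℝ} (ha : ∀ i, 0 < a i) (hw : ∀ i, 0 ≤ w i)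
    (hs : ∑' i, ENNReal.ofReal (a i * w i) ^ (2 : ℝ) < ∞) {S : Set L2} {f : L2 → ℝ} (K : ℕ → ℝ)
    (h : ∀ x ∈ S, ∀ l : List ℕ, |iterD l f x| ≤ K l.length * (l.map w).prod) : QB a S f := by
  intro k
  lift ∑' i, ENNReal.ofReal (a i * w i) ^ (2 : ℝ) to ℝ≥0 using hs.ne with T hT
  refine ⟨(K k).toNNReal ^ (2 : ℝ) * T ^ k, fun x hx => ?_⟩
  refine (derivSum_le_of_le ha hw two_pos fun l hl => (h x hx l).trans_eq (by rw [hl])).trans_eq ?_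
  rw [← hT, ENNReal.coe_mul, ENNReal.coe_rpow_of_nonneg _ two_pos.le]
  simp [ENNReal.ofReal]

lemma QB.exists_iterD_le {a : ℕ → ℝ} (ha : ∀ i, 0 < a i) {S : Set L2} {f : L2 → ℝ}
    (h : QB a S f) (l : List ℕ) : ∃ D : ℝ, 0 ≤ D ∧ ∀ x ∈ S, |iterD l f x| ≤ D := by
  obtain ⟨C, hC⟩ := h l.length
  exact GaussSobolev.exists_iterD_le ha two_pos hC

lemma QB.sum_le {a : ℕ → ℝ} {S : Set L2} {f : L2 → ℝ} (h : QB a S f) (k : ℕ) :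
    ∃ C : ℝ≥0, ∀ x ∈ S, ∑ u ∈ Finset.range (k + 1), derivSum a 2 u f x ≤ C := by
  choose C hC using h
  refine ⟨∑ u ∈ Finset.range (k + 1), C u, fun x hx => ?_⟩
  push_cast
  exact Finset.sum_le_sum fun u _ => hC u x hx

/-- Square bounds pass to products, by the Leibniz estimate. -/
lemma QB.mul {a : ℕ → ℝ} {O S : Set L2} (hO : IsOpen O) (hS : S ⊆ O) {f g : L2 → ℝ}
    (hf : FSmooth O f) (hg : FSmooth O g) (hf' : QB a S f) (hg' : QB a S g) :
    QB a S fun x => f x * g x := by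
  intro k
  obtain ⟨C, hC⟩ := lsum_leibniz_le a two_pos k
  obtain ⟨C₁, h₁⟩ := hf'.sum_le k
  obtain ⟨C₂, h₂⟩ := hg'.sum_le k
  refine ⟨C * (C₁ * C₂), fun x hx => ?_⟩
  rw [derivSum_eq]
  refine (hC (fun l => iterD l (fun x => f x * g x) x) (fun l => iterD l f x)
    (fun l => iterD l g x) fun l _ => hf.iterD_mul hO hg l (hS hx)).trans ?_
  simp only [← derivSum_eq]
  push_cast
  exact mul_le_mul_right (mul_le_mul' (h₁ x hx) (h₂ x hx)) _

lemma QB.add {a : ℕ → ℝ} {O S : Set L2} (hO : IsOpen O) (hS : S ⊆ O) {f g : L2 → ℝ}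
    (hf : FSmooth O f) (hg : FSmooth O g) (hf' : QB a S f) (hg' : QB a S g) :
    QB a S fun x => f x + g x := by
  intro k
  obtain ⟨C₁, h₁⟩ := hf' k
  obtain ⟨C₂, h₂⟩ := hg' k
  refine ⟨2 ^ (2 : ℝ) * (C₁ + C₂), fun x hx => ?_⟩
  have key : ∀ l : List ℕ, lwt a 2 l * ‖iterD l (fun x => f x + g x) x‖ₑ ^ (2 : ℝ) ≤
      2 ^ (2 : ℝ) * (lwt a 2 l * ‖iterD l f x‖ₑ ^ (2 : ℝ) +
        lwt a 2 l * ‖iterD l g x‖ₑ ^ (2 : ℝ)) := by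
    intro l
    have h := list_sum_rpow_le two_pos [‖iterD l f x‖ₑ, ‖iterD l g x‖ₑ]
    simp only [List.sum_cons, List.sum_nil, add_zero, List.length_cons, List.length_nil,
      List.map_cons, List.map_nil] at h
    rw [(hf.add_and_iterD_add hO hg).2 l (hS hx), ← mul_add, mul_left_comm]
    refine mul_le_mul_right ((ENNReal.rpow_le_rpow (enorm_add_le _ _) two_pos.le).trans
      (h.trans_eq ?_)) _
    norm_num
  rw [derivSum_eq]
  refine (lsum_mono fun l _ => key l).trans ?_
  rw [lsum_const_mul, lsum, ENNReal.tsum_add]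
  have e1 := h₁ x hx
  have e2 := h₂ x hx
  rw [derivSum_eq] at e1 e2
  rw [ENNReal.coe_mul, ENNReal.coe_rpow_of_nonneg _ two_pos.le]
  push_cast
  exact mul_le_mul_right (add_le_add e1 e2) _

lemma QB.pderiv {a : ℕ → ℝ} (ha : ∀ i, 0 < a i) {S : Set L2} {f : L2 → ℝ} (h : QB a S f) (i : ℕ) :
    QB a S (pderiv i f) := by
  intro k
  obtain ⟨C, hC⟩ := h (k + 1)
  have hw0 : lwt a 2 [i] ≠ 0 := lwt_ne_zero ha 2 _
  have hwt : lwt a 2 [i] ≠ ∞ := lwt_ne_top a two_pos.le _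
  refine ⟨((C : ℝ≥0∞) / lwt a 2 [i]).toNNReal, fun x hx => ?_⟩
  rw [ENNReal.coe_toNNReal (ENNReal.div_ne_top ENNReal.coe_ne_top hw0),
    ENNReal.le_div_iff_mul_le (Or.inl hw0) (Or.inl hwt)]
  refine le_trans ?_ (hC x hx)
  rw [derivSum_eq, derivSum_eq, mul_comm, ← lsum_const_mul]
  refine le_trans (lsum_mono fun l _ => ?_) (lsum_append_singleton_le k _ i)
  rw [lwt_append, iterD_append, ← mul_assoc, mul_comm (lwt a 2 [i])]
  rfl

lemma UniformlyIncluded.mono {E F V : Set L2} (h : UniformlyIncluded F V) (hEF : E ⊆ F) :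
    UniformlyIncluded E V := by
  obtain ⟨r, R, hr, hR, h1, h2⟩ := h
  exact ⟨r, R, hr, hR, (biUnion_subset_biUnion_left hEF).trans h1, hEF.trans h2⟩

lemma UniformlyIncluded.union {E F V : Set L2} (hE : UniformlyIncluded E V)
    (hF : UniformlyIncluded F V) : UniformlyIncluded (E ∪ F) V := by
  obtain ⟨r, R, hr, hR, h1, h2⟩ := hE
  obtain ⟨r', R', hr', hR', h1', h2'⟩ := hF
  refine ⟨min r r', max R R', lt_min hr hr', lt_max_of_lt_left hR, ?_, ?_⟩
  · simp only [iUnion_subset_iff] at h1 h1' ⊢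
    rintro x (hx | hx)
    · exact (Metric.ball_subset_ball (min_le_left _ _)).trans (h1 x hx)
    · exact (Metric.ball_subset_ball (min_le_right _ _)).trans (h1' x hx)
  · exact union_subset (h2.trans (Metric.ball_subset_ball (le_max_left _ _)))
      (h2'.trans (Metric.ball_subset_ball (le_max_right _ _)))

/-- The definition of test functions does not ask for their boundedness, but implies it: extended
by zero, such a function is differentiable along the whole first coordinate axis with the same bound
on the derivative, and it vanishes at a point of the axis at a controlled distance. -/
lemma exists_abs_le_of_uniformlyIncluded {O : Set L2} (hO : IsOpen O) {f : L2 → ℝ}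
    (hd : ∀ x ∈ O, LineDifferentiableAt ℝ f x (e 0)) {C : ℝ} (hC : ∀ x ∈ O, |pderiv 0 f x| ≤ C)
    (hU : UniformlyIncluded {x | x ∈ O ∧ f x ≠ 0} O) : ∃ D : ℝ, ∀ x ∈ O, |f x| ≤ D := by
  obtain ⟨r, R, hr, hR, h1, h2⟩ := hU
  simp only [iUnion_subset_iff] at h1
  set g : L2 → ℝ := O.indicator f with hg
  have hgd : ∀ y, ∃ d, |d| ≤ max C 0 ∧ HasLineDerivAt ℝ g d y (e 0) := by
    intro y
    by_cases hy : y ∈ O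
    · refine ⟨pderiv 0 f y, (hC y hy).trans (le_max_left _ _), ?_⟩
      refine (hd y hy).hasLineDerivAt.congr_of_eventuallyEq ?_
      filter_upwards [hO.mem_nhds hy] with z hz using indicator_of_mem hz f
    -- outside `O` the distance to the set where `f ≠ 0` is at least `r`, so `g` vanishes nearby
    · refine ⟨0, by simp, ?_⟩
      have : g =ᶠ[𝓝 y] 0 := by
        filter_upwards [Metric.ball_mem_nhds y hr] with z hz
        by_contra hne
        have hz' : z ∈ O := by
          by_contra hzO; exact hne (indicator_of_notMem hzO f)
        refine hy (h1 z ⟨hz', ?_⟩ (Metric.mem_ball_comm.1 hz))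
        rwa [hg, indicator_of_mem hz'] at hne
      have h0 : HasLineDerivAt ℝ (fun _ : L2 => (0 : ℝ)) 0 y (e 0) := hasDerivAt_const _ _
      exact h0.congr_of_eventuallyEq this
  choose d hdb hdd using hgd
  refine ⟨max C 0 * (2 * R), fun x hx => ?_⟩
  by_cases hfx : f x = 0
  · rw [hfx, abs_zero]; positivity
  have hx2 := h2 ⟨hx, hfx⟩
  rw [mem_ball_zero_iff] at hx2
  have hder : ∀ t : ℝ, HasDerivAt (fun t : ℝ => g (x + t • e 0)) (d (x + t • e 0)) t := by
    intro t
    have h := hdd (x + t • e 0)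
    have h' : HasDerivAt (fun s : ℝ => g (x + t • e 0 + s • e 0)) (d (x + t • e 0)) (t - t) := by
      rw [sub_self]; exact h
    have h'' := h'.comp_sub_const t t
    refine h''.congr_of_eventuallyEq (Eventually.of_forall fun s => ?_)
    simp only [add_assoc, ← add_smul]
    congr 3
    ring
  have hmv := Convex.norm_image_sub_le_of_norm_hasDerivWithin_le (s := univ)
    (fun t _ => (hder t).hasDerivWithinAt) (fun t _ => hdb (x + t • e 0)) convex_univ
    (mem_univ (2 * R)) (mem_univ 0)
  have hz : g (x + (2 * R) • e 0) = 0 := by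
    by_contra hne
    have hz' : x + (2 * R) • e 0 ∈ O := by
      by_contra hzO; exact hne (indicator_of_notMem hzO f)
    rw [hg, indicator_of_mem hz'] at hne
    have h3 := h2 ⟨hz', hne⟩
    rw [mem_ball_zero_iff] at h3
    have h4 := norm_sub_norm_le ((2 * R) • e 0) (-x)
    rw [norm_smul, norm_e, norm_neg, sub_neg_eq_add, add_comm _ x, Real.norm_eq_abs,
      abs_of_pos (by linarith)] at h4
    linarith
  simp only [hz, zero_smul, add_zero, sub_zero, zero_sub, norm_neg, Real.norm_eq_abs] at hmv
  rw [hg, indicator_of_mem hx, abs_of_pos (by linarith : 0 < 2 * R)] at hmv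
  exact hmv

/-- Test functions in terms of bounds of all orders, order zero included. This form is the one that
is stable under products. -/
lemma isTest_iff {a : ℕ → ℝ} (ha : ∀ i, 0 < a i) {O : Set L2} (hO : IsOpen O) {φ : L2 → ℝ} :
    IsTest a O φ ↔
      FSmooth O φ ∧ QB a O φ ∧ UniformlyIncluded {x | x ∈ O ∧ φ x ≠ 0} O := by
  constructor
  · intro h
    refine ⟨⟨h.isCFInfty.deriv_exists, fun l => ?_, fun l => ?_⟩, fun k => ?_,
      h.uniformlyIncluded⟩
    · rcases eq_or_ne l [] with rfl | hl
      · exact h.isCFInfty.fcontinuous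
      · exact h.isCFInfty.deriv_fcontinuous l hl
    · rcases eq_or_ne l [] with rfl | hl
      · exact h.isCFInfty.measurable
      · exact h.isCFInfty.deriv_measurable l hl
    · rcases Nat.eq_zero_or_pos k with rfl | hk
      · obtain ⟨C, hC⟩ := h.isCFInfty.deriv_bounded [0] (by simp)
        obtain ⟨D, hD⟩ := exists_abs_le_of_uniformlyIncluded hO
          (fun x hx => h.isCFInfty.deriv_exists [] 0 x hx) hC h.uniformlyIncluded
        refine ⟨D.toNNReal ^ (2 : ℝ), fun x hx => ?_⟩
        rw [derivSum_eq, lsum_zero, ENNReal.coe_rpow_of_nonneg _ two_pos.le]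
        simp only [lwt, List.map_nil, List.prod_nil, one_mul, iterD]
        refine ENNReal.rpow_le_rpow ?_ two_pos.le
        rw [← ofReal_norm]
        exact ENNReal.ofReal_le_ofReal (hD x hx)
      · have h1 := h.sup_lt_top k hk
        refine ⟨(⨆ x ∈ O, derivSum a 2 k φ x).toNNReal, fun x hx => ?_⟩
        rw [ENNReal.coe_toNNReal h1.ne]
        exact le_iSup₂ (f := fun x (_ : x ∈ O) => derivSum a 2 k φ x) x hx
  · rintro ⟨h1, h2, h3⟩
    refine ⟨⟨h1.fcont [], h1.meas [], h1.diff, fun l _ => ?_, fun l _ => h1.fcont l,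
      fun l _ => h1.meas l⟩, fun k _ => ?_, h3⟩
    · obtain ⟨D, -, hD⟩ := h2.exists_iterD_le ha l
      exact ⟨D, hD⟩
    · obtain ⟨C, hC⟩ := h2 k
      exact (iSup₂_le hC).trans_lt ENNReal.coe_lt_top

/-! ### Multipliers of test functions -/

/-- Functions by which test functions may be multiplied: F-smooth on all of `ℓ²`, with square
bounds on every ball around the origin. -/
structure Multiplier (a : ℕ → ℝ) (Y : L2 → ℝ) : Prop where
  fsmooth : FSmooth univ Y
  qb : ∀ R : ℝ, QB a (Metric.ball 0 R) Y

lemma Multiplier.pderiv {a : ℕ → ℝ} (ha : ∀ i, 0 < a i) {Y : L2 → ℝ} (h : Multiplier a Y) (i : ℕ) :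
    Multiplier a (pderiv i Y) :=
  ⟨h.fsmooth.iter [i], fun R => (h.qb R).pderiv ha i⟩

lemma Multiplier.iter {a : ℕ → ℝ} (ha : ∀ i, 0 < a i) {Y : L2 → ℝ} (h : Multiplier a Y)
    (l : List ℕ) : Multiplier a (iterD l Y) := by
  induction l with
  | nil => exact h
  | cons i l ih => exact ih.pderiv ha i

lemma Multiplier.mul {a : ℕ → ℝ} {Y Z : L2 → ℝ} (hY : Multiplier a Y) (hZ : Multiplier a Z) :
    Multiplier a fun x => Y x * Z x :=
  ⟨hY.fsmooth.mul isOpen_univ hZ.fsmooth, fun R =>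
    QB.mul isOpen_univ (subset_univ _) hY.fsmooth hZ.fsmooth (hY.qb R) (hZ.qb R)⟩

lemma Multiplier.add {a : ℕ → ℝ} {Y Z : L2 → ℝ} (hY : Multiplier a Y) (hZ : Multiplier a Z) :
    Multiplier a fun x => Y x + Z x :=
  ⟨(hY.fsmooth.add_and_iterD_add isOpen_univ hZ.fsmooth).1, fun R =>
    QB.add isOpen_univ (subset_univ _) hY.fsmooth hZ.fsmooth (hY.qb R) (hZ.qb R)⟩

lemma multiplier_of_isTest {a : ℕ → ℝ} (ha : ∀ i, 0 < a i) {X : L2 → ℝ} (h : IsTest a univ X) :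
    Multiplier a X := by
  obtain ⟨h1, h2, -⟩ := (isTest_iff ha isOpen_univ).1 h
  exact ⟨h1, fun R => h2.mono (subset_univ _)⟩

lemma multiplier_const {a : ℕ → ℝ} (ha : ∀ i, 0 < a i) (r : ℝ) : Multiplier a fun _ => r := by
  refine ⟨fsmooth_const univ r, fun R => ?_⟩
  refine qb_of_le ha (w := fun _ => 0) (fun _ => le_rfl) (by simp) (fun _ => |r|) fun x _ l => ?_
  cases l with
  | nil => simp [iterD]
  | cons i l => simp [iterD_const (l := i :: l) (by simp) r]

lemma continuous_coord (i : ℕ) : Continuous fun x : L2 => x i :=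
  (lp.lipschitzWith_one_eval (E := fun _ : ℕ => ℝ) 2 i).continuous

lemma hasLineDerivAt_coord (i j : ℕ) (x : L2) :
    HasLineDerivAt ℝ (fun x : L2 => x i) (if i = j then 1 else 0) x (e j) := by
  have : (fun t : ℝ => (x + t • e j) i) = fun t => x i + t * (if i = j then 1 else 0) := by
    ext t
    change x i + t * (e j : ℕ → ℝ) i = _
    rw [e_apply]
  unfold HasLineDerivAt
  rw [this]
  simpa using ((hasDerivAt_id (0 : ℝ)).mul_const (if i = j then (1 : ℝ) else 0)).const_add (x i)

lemma abs_coord_le (x : L2) (i : ℕ) : |x i| ≤ ‖x‖ := lp.norm_apply_le_norm (by norm_num) x i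

lemma multiplier_coord {a : ℕ → ℝ} (ha : ∀ i, 0 < a i) (i : ℕ) :
    Multiplier a fun x : L2 => x i := by
  let w : ℕ → ℝ := fun j => if i = j then 1 else 0
  have hw : ∀ j, 0 ≤ w j := fun j => by dsimp [w]; split <;> norm_num
  let G : List ℕ → L2 → ℝ
    | [] => fun x => x i
    | [j] => fun _ => w j
    | _ :: _ :: _ => fun _ => 0
  have hG : ∀ l, Continuous (G l) := by
    rintro (_ | ⟨j, _ | ⟨k, l⟩⟩)
    exacts [continuous_coord i, continuous_const, continuous_const]
  obtain ⟨h1, h2⟩ := FSmooth.of_family (f := fun x : L2 => x i) isOpen_univ G (fun x _ => rfl) (by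
    rintro (_ | ⟨j, _ | ⟨k, l⟩⟩) m x -
    exacts [hasLineDerivAt_coord i m x, hasDerivAt_const _ _, hasDerivAt_const _ _])
    (fun l => fContinuousOn_of_continuous (hG l) _)
    (fun l => (hG l).measurable.comp measurable_subtype_coe)
  refine ⟨h1, fun R => qb_of_le ha hw ?_ (fun k => if k = 0 then R else 1) fun x hx l => ?_⟩
  · rw [tsum_eq_single i fun j hj => by simp [w, Ne.symm hj]]
    simp [w]
  · rw [h2 l (mem_univ x)]
    rcases l with _ | ⟨j, _ | ⟨k, l⟩⟩
    · rw [mem_ball_zero_iff] at hx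
      simpa [G] using (abs_coord_le x i).trans hx.le
    · simp [G, abs_of_nonneg (hw j)]
    · have : 0 ≤ ((j :: k :: l).map w).prod :=
        List.prod_nonneg (by simpa using ⟨hw j, hw k, fun a _ => hw a⟩)
      simpa [G] using this

/-- Derivatives of a function that vanishes on an open set vanish there. -/
lemma iterD_eq_zero_of_eqOn {O : Set L2} (hO : IsOpen O) {f : L2 → ℝ} (h : ∀ x ∈ O, f x = 0)
    (l : List ℕ) {x : L2} (hx : x ∈ O) : iterD l f x = 0 := by
  rw [iterD_congr hO (g := fun _ => 0) h l hx, iterD_zero]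

/-- Away from a ball containing the set where `f` does not vanish, square bounds are trivial. -/
lemma QB.of_inter_ball {a : ℕ → ℝ} {O : Set L2} (hO : IsOpen O) {f : L2 → ℝ} {R : ℝ}
    (h : QB a (O ∩ Metric.ball 0 (R + 1)) f) (hR : {x | x ∈ O ∧ f x ≠ 0} ⊆ Metric.ball 0 R) :
    QB a O f := by
  intro k
  obtain ⟨C, hC⟩ := h k
  refine ⟨C, fun x hx => ?_⟩
  by_cases hxb : x ∈ Metric.ball (0 : L2) (R + 1)
  · exact hC x ⟨hx, hxb⟩
  · have hxU : x ∈ O ∩ (Metric.closedBall (0 : L2) R)ᶜ := by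
      refine ⟨hx, fun hxc => hxb (Metric.closedBall_subset_ball (by linarith) hxc)⟩
    have hz : ∀ y ∈ O ∩ (Metric.closedBall (0 : L2) R)ᶜ, f y = 0 := by
      rintro y ⟨hy, hy'⟩
      by_contra hne
      exact hy' (Metric.ball_subset_closedBall (hR ⟨hy, hne⟩))
    have : ∀ l, iterD l f x = 0 := fun l =>
      iterD_eq_zero_of_eqOn (hO.inter Metric.isClosed_closedBall.isOpen_compl) hz l hxU
    rw [derivSum_eq]
    simp [this, lsum]

/-- Multipliers preserve test functions: they need only be bounded near the bounded set where the
test function does not vanish. -/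
lemma IsTest.mul_left {a : ℕ → ℝ} (ha : ∀ i, 0 < a i) {O : Set L2} (hO : IsOpen O)
    {Y φ : L2 → ℝ} (hY : Multiplier a Y) (hφ : IsTest a O φ) : IsTest a O fun x => Y x * φ x := by
  rw [isTest_iff ha hO] at hφ ⊢
  obtain ⟨h1, h2, h3⟩ := hφ
  have h4 : UniformlyIncluded {x | x ∈ O ∧ Y x * φ x ≠ 0} O :=
    h3.mono fun x hx => ⟨hx.1, right_ne_zero_of_mul hx.2⟩
  have hYO := hY.fsmooth.mono (subset_univ O)
  refine ⟨hYO.mul hO h1, ?_, h4⟩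
  obtain ⟨r, R, -, -, -, hR⟩ := h4
  exact QB.of_inter_ball hO (QB.mul hO inter_subset_left hYO h1
    ((hY.qb (R + 1)).mono inter_subset_right) (h2.mono inter_subset_left)) hR

lemma IsTest.add {a : ℕ → ℝ} (ha : ∀ i, 0 < a i) {O : Set L2} (hO : IsOpen O)
    {φ ψ : L2 → ℝ} (hφ : IsTest a O φ) (hψ : IsTest a O ψ) : IsTest a O fun x => φ x + ψ x := by
  rw [isTest_iff ha hO] at hφ hψ ⊢
  refine ⟨(hφ.1.add_and_iterD_add hO hψ.1).1,
    QB.add hO Subset.rfl hφ.1 hψ.1 hφ.2.1 hψ.2.1, (hφ.2.2.union hψ.2.2).mono ?_⟩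
  rintro x ⟨hx, hne⟩
  by_contra h
  simp only [mem_union, mem_ofPred_eq, not_or, not_and, not_not] at h
  exact hne (by rw [h.1 hx, h.2 hx, add_zero])

lemma IsTest.pderiv {a : ℕ → ℝ} (ha : ∀ i, 0 < a i) {O : Set L2} (hO : IsOpen O)
    {φ : L2 → ℝ} (hφ : IsTest a O φ) (i : ℕ) : IsTest a O (pderiv i φ) := by
  rw [isTest_iff ha hO] at hφ ⊢
  refine ⟨hφ.1.iter [i], hφ.2.1.pderiv ha i, ?_⟩
  obtain ⟨r, R, hr, hR, h1, h2⟩ := hφ.2.2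
  -- the derivative can only be nonzero close to points where `φ` is nonzero
  have key : ∀ x ∈ {x | x ∈ O ∧ GaussSobolev.pderiv i φ x ≠ 0}, ∃ y ∈ {x | x ∈ O ∧ φ x ≠ 0},
      dist x y < min (r / 2) 1 := by
    rintro x ⟨hx, hne⟩
    by_contra! hcon
    refine hne (iterD_eq_zero_of_eqOn (hO.inter Metric.isOpen_ball) (l := [i])
      (x := x) (O := O ∩ Metric.ball x (min (r / 2) 1)) ?_ ⟨hx, Metric.mem_ball_self (by positivity)⟩)
    rintro y ⟨hy, hyx⟩
    by_contra hφy
    have := hcon y ⟨hy, hφy⟩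
    rw [Metric.mem_ball'] at hyx
    linarith
  refine ⟨r / 2, R + 1, by positivity, by positivity, ?_, ?_⟩
  · simp only [iUnion_subset_iff] at h1 ⊢
    intro x hx
    obtain ⟨y, hy, hxy⟩ := key x hx
    have := hxy.trans_le (min_le_left _ _)
    exact (Metric.ball_subset_ball' (by linarith)).trans (h1 y hy)
  · intro x hx
    obtain ⟨y, hy, hxy⟩ := key x hx
    have h3 := hxy.trans_le (min_le_right _ _)
    have h4 := h2 hy
    rw [Metric.mem_ball] at h4 ⊢
    linarith [dist_triangle x y 0]

lemma IsTest.dualD {a : ℕ → ℝ} (ha : ∀ i, 0 < a i) {O : Set L2} (hO : IsOpen O)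
    {φ : L2 → ℝ} (hφ : IsTest a O φ) (i : ℕ) : IsTest a O (dualD a i φ) := by
  have h1 := IsTest.mul_left ha hO (multiplier_const ha (-1)) (hφ.pderiv ha hO i)
  have h2 := IsTest.mul_left ha hO
    ((multiplier_const ha (1 / a i ^ 2)).mul (multiplier_coord ha i)) hφ
  convert IsTest.add ha hO h1 h2 using 1
  ext x
  simp only [GaussSobolev.dualD]
  ring

lemma IsTest.iterDual {a : ℕ → ℝ} (ha : ∀ i, 0 < a i) {O : Set L2} (hO : IsOpen O)
    {φ : L2 → ℝ} (hφ : IsTest a O φ) (l : List ℕ) : IsTest a O (iterDual a l φ) := by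
  induction l generalizing φ with
  | nil => exact hφ
  | cons i l ih => exact ih (hφ.dualD ha hO i)

lemma IsTest.fsmooth {a : ℕ → ℝ} (ha : ∀ i, 0 < a i) {O : Set L2} (hO : IsOpen O)
    {φ : L2 → ℝ} (hφ : IsTest a O φ) : FSmooth O φ := ((isTest_iff ha hO).1 hφ).1

lemma IsTest.exists_abs_le {a : ℕ → ℝ} (ha : ∀ i, 0 < a i) {O : Set L2} (hO : IsOpen O)
    {φ : L2 → ℝ} (hφ : IsTest a O φ) (l : List ℕ) :
    ∃ D : ℝ, 0 ≤ D ∧ ∀ x ∈ O, |iterD l φ x| ≤ D :=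
  ((isTest_iff ha hO).1 hφ).2.1.exists_iterD_le ha l

lemma dualD_congr {a : ℕ → ℝ} {O : Set L2} (hO : IsOpen O) {f g : L2 → ℝ} (h : EqOn f g O)
    (i : ℕ) : EqOn (dualD a i f) (dualD a i g) O := by
  intro x hx
  have := iterD_congr hO h [i] hx
  simp only [iterD] at this
  simp only [dualD, this, h hx]

lemma iterDual_congr {a : ℕ → ℝ} {O : Set L2} (hO : IsOpen O) {f g : L2 → ℝ} (h : EqOn f g O)
    (l : List ℕ) : EqOn (iterDual a l f) (iterDual a l g) O := by
  induction l generalizing f g with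
  | nil => exact h
  | cons i l ih => exact ih (dualD_congr hO h i)

lemma iterDual_add {a : ℕ → ℝ} (ha : ∀ i, 0 < a i) {O : Set L2} (hO : IsOpen O)
    {φ ψ : L2 → ℝ} (hφ : IsTest a O φ) (hψ : IsTest a O ψ) (l : List ℕ) :
    EqOn (iterDual a l fun x => φ x + ψ x) (fun x => iterDual a l φ x + iterDual a l ψ x) O := by
  induction l generalizing φ ψ with
  | nil => exact fun x _ => rfl
  | cons i l ih =>
    have : EqOn (dualD a i fun x => φ x + ψ x) (fun x => dualD a i φ x + dualD a i ψ x) O := by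
      intro x hx
      have h := ((hφ.fsmooth ha hO).add_and_iterD_add hO (hψ.fsmooth ha hO)).2 [i] hx
      simp only [iterD] at h
      simp only [dualD, h]
      ring
    exact fun x hx => (iterDual_congr hO this l hx).trans (ih (hφ.dualD ha hO i) (hψ.dualD ha hO i) hx)

/-- Multiplication by `Y` and the dual derivatives: `Y D_i^* φ = D_i^* (Y φ) + (D_i Y) φ`,
iterated. No integration is involved. -/
lemma mul_iterDual {a : ℕ → ℝ} (ha : ∀ i, 0 < a i) {O : Set L2} (hO : IsOpen O)
    {Y φ : L2 → ℝ} (hY : Multiplier a Y) (hφ : IsTest a O φ) (l : List ℕ) {x : L2} (hx : x ∈ O) :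
    Y x * iterDual a l φ x =
      ((splits l).map fun s => iterDual a s.2 (fun y => iterD s.1 Y y * φ y) x).sum := by
  induction l generalizing φ with
  | nil => simp [splits, iterDual, iterD]
  | cons i l ih =>
    have key : ∀ S : List ℕ, EqOn (fun y => iterD S Y y * dualD a i φ y)
        (fun y => iterD (i :: S) Y y * φ y + dualD a i (fun y => iterD S Y y * φ y) y) O := by
      intro S y hy
      have h := FSmooth.iterD_mul hO ((hY.fsmooth.mono (subset_univ O)).iter S)
        (hφ.fsmooth ha hO) [i] hy
      simp only [splits, iterD, List.map_cons, List.map_nil, List.cons_append, List.nil_append,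
        List.sum_cons, List.sum_nil, add_zero] at h
      simp only [dualD, h, iterD]
      ring
    simp only [iterDual, splits, List.map_append, List.map_map, List.sum_append, Function.comp_def]
    rw [ih (hφ.dualD ha hO i), ← List.sum_map_add]
    congr 1
    refine List.map_congr_left fun s _ => ?_
    rw [iterDual_congr hO (key s.1) s.2 hx, iterDual_add ha hO
      (IsTest.mul_left ha hO (hY.iter ha _) hφ)
      ((IsTest.mul_left ha hO (hY.iter ha _) hφ).dualD ha hO i) s.2 hx]

/-! ### The Gaussian measure -/

instance instSecondCountableL2 : SecondCountableTopology L2 := by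
  have hsep : TopologicalSpace.IsSeparable ((Submodule.span ℝ (range e) : Submodule ℝ L2) : Set L2) :=
    (countable_range e).isSeparable.span
  have hcl : closure ((Submodule.span ℝ (range e) : Submodule ℝ L2) : Set L2) = univ := by
    refine eq_univ_of_forall fun x => ?_
    refine mem_closure_of_tendsto (lp.hasSum_single (E := fun _ : ℕ => ℝ) (by norm_num) x)
      (Eventually.of_forall fun s => ?_)
    refine Submodule.sum_mem _ fun i _ => ?_
    have : lp.single (E := fun _ : ℕ => ℝ) 2 i (x i) = x i • e i := by
      rw [e, ← lp.single_smul, smul_eq_mul, mul_one]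
    rw [this]
    exact Submodule.smul_mem _ _ (Submodule.subset_span (mem_range_self i))
  have hs : TopologicalSpace.SeparableSpace L2 :=
    TopologicalSpace.isSeparable_univ_iff.1 (hcl ▸ hsep.closure)
  exact UniformSpace.secondCountable_of_separable L2

/-- This makes the comap in the definition of `P` a genuine restriction of the product measure. -/
lemma measurableEmbedding_coe : MeasurableEmbedding fun (x : L2) (i : ℕ) => x i := by
  refine Continuous.measurableEmbedding (continuous_pi continuous_coord) fun x y h => ?_
  exact lp.ext h

instance instIsFiniteMeasureP (a : ℕ → ℝ) : IsFiniteMeasure (P a) := by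
  refine ⟨?_⟩
  rw [P, measurableEmbedding_coe.comap_apply]
  exact measure_lt_top _ _

/-- Under `P`, the weighted sums of squares `∑ c_i x_i²` are almost surely finite as soon as the
sum of their expectations is. -/
lemma ae_tsum_lt_top {a c : ℕ → ℝ} (hc : ∀ i, 0 ≤ c i)
    (hs : ∑' i, ENNReal.ofReal (c i * a i ^ 2) < ∞) :
    ∀ᵐ x ∂(P a), ∑' i, ENNReal.ofReal (c i * x i ^ 2) < ∞ := by
  have hμ : ∀ᵐ y ∂(Measure.infinitePi fun i => gaussianReal 0 (Real.toNNReal (a i ^ 2))),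
      ∑' i, ENNReal.ofReal (c i * y i ^ 2) < ∞ := by
    refine ae_lt_top (by fun_prop) ?_
    rw [lintegral_tsum fun i => Measurable.aemeasurable (by fun_prop)]
    refine ne_of_lt (lt_of_le_of_lt (le_of_eq (tsum_congr fun i => ?_)) hs)
    have h1 := (measurePreserving_eval_infinitePi
      (fun i => gaussianReal 0 (Real.toNNReal (a i ^ 2))) i).lintegral_comp
      (f := fun t => ENNReal.ofReal (c i * t ^ 2)) (by fun_prop)
    simp only [Function.eval] at h1
    rw [h1]
    have h2 : Integrable (fun t : ℝ => c i * t ^ 2) (gaussianReal 0 (Real.toNNReal (a i ^ 2))) :=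
      ((memLp_id_gaussianReal' 2 (by norm_num)).integrable_sq).const_mul _
    rw [← ofReal_integral_eq_lintegral_ofReal h2
      (Eventually.of_forall fun t => mul_nonneg (hc i) (sq_nonneg t)), integral_const_mul]
    have h3 := variance_id_gaussianReal (μ := 0) (v := Real.toNNReal (a i ^ 2))
    rw [variance_of_integral_eq_zero (by fun_prop) (by simp [integral_id_gaussianReal])] at h3
    simp only [id] at h3
    rw [h3, Real.coe_toNNReal _ (sq_nonneg _)]
  rw [ae_iff] at hμ ⊢
  rw [P, measurableEmbedding_coe.comap_apply]
  refine measure_mono_null ?_ hμ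
  rintro _ ⟨x, hx, rfl⟩
  exact hx

lemma aestronglyMeasurable_restrict {a : ℕ → ℝ} {O : Set L2} (hO : IsOpen O) {f : L2 → ℝ}
    (hf : Measurable fun x : O => f x) : AEStronglyMeasurable f ((P a).restrict O) :=
  ((aemeasurable_restrict_iff_comap_subtype hO.measurableSet).2
    hf.aemeasurable).aestronglyMeasurable

/-! ### Weak derivatives of products -/

section Product

variable {a : ℕ → ℝ} {p : ℝ} {O : Set L2}

lemma integrable_of_memLp (hp : 1 ≤ p) {f : L2 → ℝ}
    (hf : MemLp f (ENNReal.ofReal p) ((P a).restrict O)) : Integrable f ((P a).restrict O) :=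
  hf.integrable (by rw [← ENNReal.ofReal_one]; exact ENNReal.ofReal_le_ofReal hp)

lemma ae_restrict_of_forall (hO : IsOpen O) {Q : L2 → Prop} (h : ∀ x ∈ O, Q x) :
    ∀ᵐ x ∂(P a).restrict O, Q x := by
  filter_upwards [ae_restrict_mem hO.measurableSet] with x hx using h x hx

lemma memLp_bounded_mul (hO : IsOpen O) {f Y : L2 → ℝ} {q : ℝ≥0∞}
    (hf : MemLp f q ((P a).restrict O))
    (hY : Measurable fun x : O => Y x) {D : ℝ} (hD : ∀ x ∈ O, |Y x| ≤ D) :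
    MemLp (fun x => Y x * f x) q ((P a).restrict O) :=
  hf.of_le_mul (c := D) ((aestronglyMeasurable_restrict hO hY).mul hf.1)
    (ae_restrict_of_forall hO fun x hx => by
      rw [norm_mul]; exact mul_le_mul_of_nonneg_right (hD x hx) (norm_nonneg _))

lemma IsTest.integrable_mul (ha : ∀ i, 0 < a i) (hO : IsOpen O) {f φ : L2 → ℝ}
    (hf : Integrable f ((P a).restrict O)) (hφ : IsTest a O φ) :
    Integrable (fun x => f x * φ x) ((P a).restrict O) := by
  obtain ⟨D, -, hD⟩ := hφ.exists_abs_le ha hO []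
  rw [← memLp_one_iff_integrable] at hf ⊢
  simp only [mul_comm (f _)]
  exact memLp_bounded_mul hO hf ((hφ.fsmooth ha hO).meas []) hD

lemma integral_list_sum {α ι : Type*} [MeasurableSpace α] {μ : Measure α} (L : List ι)
    (F : ι → α → ℝ) (h : ∀ s ∈ L, Integrable (F s) μ) :
    Integrable (fun x => (L.map fun s => F s x).sum) μ ∧
      ∫ x, (L.map fun s => F s x).sum ∂μ = (L.map fun s => ∫ x, F s x ∂μ).sum := by
  induction L with
  | nil => simp
  | cons s L ih =>
    obtain ⟨h1, h2⟩ := ih fun t ht => h t (by simp [ht])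
    have h3 := h s (by simp)
    simp only [List.map_cons, List.sum_cons]
    exact ⟨h3.add h1, by rw [integral_add h3 h1, h2]⟩

lemma memLp_list_sum {α ι : Type*} [MeasurableSpace α] {μ : Measure α} {q : ℝ≥0∞} (L : List ι)
    (F : ι → α → ℝ) (h : ∀ s ∈ L, MemLp (F s) q μ) :
    MemLp (fun x => (L.map fun s => F s x).sum) q μ := by
  induction L with
  | nil => simp
  | cons s L ih =>
    simp only [List.map_cons, List.sum_cons]
    exact (h s (by simp)).add (ih fun t ht => h t (by simp [ht]))

/-- The Leibniz rule for weak derivatives: if `g S` is the weak derivative of `f` of index `S`,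
then the weak derivative of `Y f` is given by the usual sum over splittings of the index. -/
lemma isWeakDeriv_mul (ha : ∀ i, 0 < a i) (hp : 1 ≤ p) (hO : IsOpen O) {f Y : L2 → ℝ}
    (hY : Multiplier a Y) (hYb : ∀ l, ∃ D : ℝ, ∀ x ∈ O, |iterD l Y x| ≤ D)
    (hf : MemLp f (ENNReal.ofReal p) ((P a).restrict O)) (g : List ℕ → L2 → ℝ) (l : List ℕ)
    (hg : ∀ s ∈ splits l, IsWeakDeriv a p O s.2 f (g s.2)) :
    IsWeakDeriv a p O l (fun x => Y x * f x)
      (fun x => ((splits l).map fun s => iterD s.1 Y x * g s.2 x).sum) := by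
  refine ⟨memLp_list_sum _ _ fun s hs => ?_, fun φ hφ => ?_⟩
  · obtain ⟨D, hD⟩ := hYb s.1
    exact memLp_bounded_mul hO (hg s hs).1
      (((hY.iter ha s.1).fsmooth.mono (subset_univ O)).meas []) hD
  have hT : ∀ S, IsTest a O fun y => iterD S Y y * φ y := fun S =>
    IsTest.mul_left ha hO (hY.iter ha S) hφ
  have h1 : ∀ s ∈ splits l, Integrable (fun x => g s.2 x * (iterD s.1 Y x * φ x))
      ((P a).restrict O) := fun s hs =>
    IsTest.integrable_mul ha hO (integrable_of_memLp hp (hg s hs).1) (hT s.1)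
  have h2 : ∀ s ∈ splits l, Integrable
      (fun x => f x * iterDual a s.2 (fun y => iterD s.1 Y y * φ y) x)
      ((P a).restrict O) := fun s _ =>
    IsTest.integrable_mul ha hO (integrable_of_memLp hp hf) ((hT s.1).iterDual ha hO s.2)
  calc ∫ x in O, ((splits l).map fun s => iterD s.1 Y x * g s.2 x).sum * φ x ∂(P a)
      = ∫ x in O, ((splits l).map fun s => g s.2 x * (iterD s.1 Y x * φ x)).sum ∂(P a) := by
        congr 1; ext x
        rw [← List.sum_map_mul_right]
        congr 1
        exact List.map_congr_left fun s _ => by ring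
    _ = ((splits l).map fun s =>
          ∫ x in O, f x * iterDual a s.2 (fun y => iterD s.1 Y y * φ y) x ∂(P a)).sum := by
        rw [(integral_list_sum _ _ h1).2]
        congr 1
        exact List.map_congr_left fun s hs => (hg s hs).2 _ (hT s.1)
    _ = ∫ x in O, ((splits l).map fun s =>
          f x * iterDual a s.2 (fun y => iterD s.1 Y y * φ y) x).sum ∂(P a) :=
        (integral_list_sum _ _ h2).2.symm
    _ = ∫ x in O, Y x * f x * iterDual a l φ x ∂(P a) := by
        refine setIntegral_congr_fun hO.measurableSet fun x hx => ?_
        rw [List.sum_map_mul_left, ← mul_iterDual ha hO hY hφ l hx]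
        ring

lemma isWeakDeriv_nil {f : L2 → ℝ} (hf : MemLp f (ENNReal.ofReal p) ((P a).restrict O)) :
    IsWeakDeriv a p O [] f f := ⟨hf, fun _ _ => rfl⟩

end Product

/-! ### Smooth bumps built from weighted quadratic forms -/

/-- A smooth function on the line, equal to `1` on `(-∞, 1]` and to `0` on `[2, ∞)`. -/
noncomputable def cutoff (t : ℝ) : ℝ := Real.smoothTransition (2 - t)

lemma contDiff_cutoff {n : ℕ∞} : ContDiff ℝ n cutoff :=
  Real.smoothTransition.contDiff.comp (contDiff_const.sub contDiff_id)

lemma cutoff_eq_one {t : ℝ} (h : t ≤ 1) : cutoff t = 1 :=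
  Real.smoothTransition.one_of_one_le (by linarith)

lemma cutoff_eq_zero {t : ℝ} (h : 2 ≤ t) : cutoff t = 0 :=
  Real.smoothTransition.zero_of_nonpos (by linarith)

lemma cutoff_mem_Icc (t : ℝ) : cutoff t ∈ Icc (0 : ℝ) 1 :=
  ⟨Real.smoothTransition.nonneg _, Real.smoothTransition.le_one _⟩

/-- The `j`-th derivative of `cutoff`. -/
noncomputable def cutoffD (j : ℕ) : ℝ → ℝ := iteratedDeriv j cutoff

lemma continuous_cutoffD (j : ℕ) : Continuous (cutoffD j) :=
  (contDiff_cutoff (n := ⊤)).continuous_iteratedDeriv j (mod_cast le_top)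

lemma hasDerivAt_cutoffD (j : ℕ) (t : ℝ) : HasDerivAt (cutoffD j) (cutoffD (j + 1) t) t := by
  have := ((contDiff_cutoff (n := ⊤)).differentiable_iteratedDeriv j
    (mod_cast ENat.natCast_lt_top j) t).hasDerivAt
  rw [cutoffD, cutoffD, iteratedDeriv_succ]
  exact this

lemma cutoffD_eq_zero_of_lt {t : ℝ} (h : 2 < t) (j : ℕ) : cutoffD j t = 0 := by
  have : cutoff =ᶠ[𝓝 t] fun _ => 0 := by
    filter_upwards [lt_mem_nhds h] with s hs using cutoff_eq_zero hs.le
  rw [cutoffD, this.iteratedDeriv_eq]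
  simp

lemma cutoffD_eq_zero_of_lt_one {t : ℝ} (h : t < 1) {j : ℕ} (hj : 1 ≤ j) : cutoffD j t = 0 := by
  have : cutoff =ᶠ[𝓝 t] fun _ => 1 := by
    filter_upwards [gt_mem_nhds h] with s hs using cutoff_eq_one hs.le
  rw [cutoffD, this.iteratedDeriv_eq]
  simp [iteratedDeriv_const]
  omega

lemma exists_cutoffD_le (k : ℕ) : ∃ B : ℝ, 0 ≤ B ∧ ∀ j ≤ k, ∀ t, 0 ≤ t → |cutoffD j t| ≤ B := by
  have h : ∀ j, ∃ B : ℝ, 0 ≤ B ∧ ∀ t, 0 ≤ t → |cutoffD j t| ≤ B := by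
    intro j
    obtain ⟨B, hB⟩ := (isCompact_Icc (a := (0 : ℝ)) (b := 2)).exists_bound_of_continuousOn
      (continuous_cutoffD j).continuousOn
    have hB0 : 0 ≤ B := (norm_nonneg _).trans (hB 0 (by simp))
    refine ⟨B, hB0, fun t ht => ?_⟩
    rcases le_or_gt t 2 with h2 | h2
    · exact hB t ⟨ht, h2⟩
    · rw [cutoffD_eq_zero_of_lt h2, abs_zero]; exact hB0
  choose B hB0 hB using h
  refine ⟨∑ j ∈ Finset.range (k + 1), B j, Finset.sum_nonneg fun j _ => hB0 j, fun j hj t ht => ?_⟩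
  exact (hB j t ht).trans (Finset.single_le_sum (fun j _ => hB0 j) (Finset.mem_range.2 (by omega)))

/-- The quadratic form `∑ w_i (y_i - z_i)²`, with values in `[0, ∞]`. -/
noncomputable def wq (w : ℕ → ℝ) (z y : L2) : ℝ≥0∞ := ∑' i, ENNReal.ofReal (w i * (y i - z i) ^ 2)

/-- The `j`-th derivative of the cutoff, evaluated at the quadratic form, and `0` where the latter
is infinite. -/
noncomputable def cutH (w : ℕ → ℝ) (z : L2) (j : ℕ) (y : L2) : ℝ :=
  if wq w z y = ∞ then 0 else cutoffD j (wq w z y).toReal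

/-- The bump `cutoff (∑ w_i (y_i - z_i)²)`. -/
noncomputable def bump (w : ℕ → ℝ) (z : L2) : L2 → ℝ := cutH w z 0

lemma coord_add (y v : L2) (i : ℕ) : (y + v : L2) i = y i + v i := by
  rw [lp.coeFn_add, Pi.add_apply]

lemma coord_smul_e (t : ℝ) (i k : ℕ) : (t • e i : L2) k = t * if k = i then 1 else 0 := by
  rw [lp.coeFn_smul, Pi.smul_apply, e_apply, smul_eq_mul]

section Bump

variable {w : ℕ → ℝ} {z : L2}

lemma measurable_wq : Measurable (wq w z) := by
  refine Measurable.tsum fun i => ?_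
  exact ENNReal.measurable_ofReal.comp (measurable_const.mul
    (((continuous_coord i).measurable.sub_const _).pow_const 2))

lemma measurable_cutH (j : ℕ) : Measurable (cutH w z j) :=
  Measurable.ite (measurable_wq (measurableSet_singleton _)) measurable_const
    ((continuous_cutoffD j).measurable.comp measurable_wq.ennreal_toReal)

lemma bump_mem_Icc (y : L2) : bump w z y ∈ Icc (0 : ℝ) 1 := by
  unfold bump cutH
  split
  · simp
  · exact cutoff_mem_Icc _

lemma bump_eq_one {y : L2} (h : wq w z y ≤ 1) : bump w z y = 1 := by
  rw [bump, cutH, if_neg (h.trans_lt ENNReal.one_lt_top).ne]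
  exact cutoff_eq_one (ENNReal.toReal_le_of_le_ofReal one_pos.le (by simpa using h))

lemma wq_le_of_cutH_ne_zero {y : L2} {j : ℕ} (h : cutH w z j y ≠ 0) : wq w z y ≤ 2 := by
  rw [cutH] at h
  by_cases htop : wq w z y = ∞
  · simp [htop] at h
  rw [if_neg htop] at h
  by_contra! hlt
  refine h (cutoffD_eq_zero_of_lt ?_ j)
  rw [← ENNReal.toReal_ofNat 2]
  exact (ENNReal.toReal_lt_toReal (by norm_num) htop).2 hlt

/-- Along finitely many coordinates the form is either identically infinite or a polynomial. -/
lemma cutH_add (hw : ∀ i, 0 ≤ w i) (N : ℕ) (y : L2) :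
    (∀ v : L2, (∀ i, N ≤ i → v i = 0) → ∀ j, cutH w z j (y + v) = 0) ∨
    ∃ τ : ℝ, ∀ v : L2, (∀ i, N ≤ i → v i = 0) → ∀ j, cutH w z j (y + v) =
      cutoffD j (∑ i ∈ Finset.range N, w i * (y i + v i - z i) ^ 2 + τ) := by
  set T : ℝ≥0∞ := ∑' i, ENNReal.ofReal (w (i + N) * (y (i + N) - z (i + N)) ^ 2) with hT
  have hsplit : ∀ v : L2, (∀ i, N ≤ i → v i = 0) → wq w z (y + v) =
      ENNReal.ofReal (∑ i ∈ Finset.range N, w i * (y i + v i - z i) ^ 2) + T := by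
    intro v hv
    rw [wq, ← Summable.sum_add_tsum_nat_add' (k := N) ENNReal.summable, ENNReal.ofReal_sum_of_nonneg
      fun i _ => mul_nonneg (hw i) (sq_nonneg _)]
    congr 1
    refine tsum_congr fun i => ?_
    rw [coord_add, hv _ (by omega), add_zero]
  by_cases hTt : T = ∞
  · left
    intro v hv j
    rw [cutH, if_pos (by rw [hsplit v hv, hTt, add_top])]
  · right
    refine ⟨T.toReal, fun v hv j => ?_⟩
    have hne : wq w z (y + v) ≠ ∞ := by rw [hsplit v hv]; simp [hTt]
    rw [cutH, if_neg hne, hsplit v hv, ENNReal.toReal_add ENNReal.ofReal_ne_top hTt,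
      ENNReal.toReal_ofReal (Finset.sum_nonneg fun i _ => mul_nonneg (hw i) (sq_nonneg _))]

lemma coe_sum_smul_e (l : ℕ) (s : Fin l → ℝ) (i : ℕ) :
    (∑ j, s j • e j : L2) i = ∑ j : Fin l, s j * (if i = j then 1 else 0) := by
  rw [lp.coeFn_sum, Finset.sum_apply]
  refine Finset.sum_congr rfl fun j _ => ?_
  exact coord_smul_e _ _ _

lemma fContinuousOn_cutH (hw : ∀ i, 0 ≤ w i) (j : ℕ) (O : Set L2) :
    FContinuousOn (cutH w z j) O := by
  refine FContinuousOn.mono (U := univ) ?_ (subset_univ _)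
  intro y _ l
  refine Continuous.continuousOn ?_
  have hv : ∀ s : Fin l → ℝ, ∀ i, l ≤ i → (∑ j, s j • e j : L2) i = 0 := by
    intro s i hi
    rw [coe_sum_smul_e]
    exact Finset.sum_eq_zero fun j _ => by rw [if_neg (by omega), mul_zero]
  rcases cutH_add (z := z) hw l y with h | ⟨τ, h⟩
  · simp only [fun s => h _ (hv s) j]
    exact continuous_const
  · simp only [fun s => h _ (hv s) j, coe_sum_smul_e]
    exact (continuous_cutoffD j).comp (by fun_prop)

lemma hasLineDerivAt_cutH (hw : ∀ i, 0 ≤ w i) (j i : ℕ) (y : L2) :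
    HasLineDerivAt ℝ (cutH w z j) (cutH w z (j + 1) y * (2 * w i * (y i - z i))) y (e i) := by
  have hv : ∀ t : ℝ, ∀ k, i + 1 ≤ k → (t • e i : L2) k = 0 := by
    intro t k hk
    rw [coord_smul_e, if_neg (by omega), mul_zero]
  have hv0 : ∀ k, i + 1 ≤ k → (0 : L2) k = 0 := fun _ _ => rfl
  unfold HasLineDerivAt
  rcases cutH_add (z := z) hw (i + 1) y with h | ⟨τ, h⟩
  · have h0 := h 0 hv0 (j + 1)
    rw [add_zero] at h0
    simp only [fun t => h _ (hv t) j, h0, zero_mul]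
    exact hasDerivAt_const _ _
  · have h0 := h 0 hv0 (j + 1)
    rw [add_zero] at h0
    simp only [fun t => h _ (hv t) j, h0]
    have hin : HasDerivAt (fun t : ℝ =>
        ∑ k ∈ Finset.range (i + 1), w k * (y k + (t • e i : L2) k - z k) ^ 2 + τ)
        (∑ k ∈ Finset.range (i + 1), w k * (2 * (y k - z k) * (if k = i then 1 else 0))) 0 := by
      refine HasDerivAt.add_const τ (HasDerivAt.fun_sum fun k _ => ?_)
      simp only [coord_smul_e]
      have h2 := ((((hasDerivAt_id (0 : ℝ)).mul_const (if k = i then (1 : ℝ) else 0)).const_add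
        (y k)).sub_const (z k)).pow 2
      have h3 := h2.const_mul (w k)
      simpa using h3
    have hc := HasDerivAt.comp (0 : ℝ) (hasDerivAt_cutoffD j _) hin
    refine HasDerivAt.congr_deriv hc ?_
    simp only [zero_smul]
    congr 1
    rw [Finset.sum_eq_single i (fun k _ hk => by simp [hk]) (by simp)]
    simp
    ring

/-- The monomial `∏ (y_i - z_i)` over the entries `i` of a list. -/
noncomputable def mon (z : L2) (M : List ℕ) (y : L2) : ℝ := (M.map fun i => y i - z i).prod

lemma mon_cons (i : ℕ) (M : List ℕ) :
    mon z (i :: M) = fun y => (y i - z i) * mon z M y := by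
  ext y; simp [mon]

lemma continuous_mon (M : List ℕ) : Continuous (mon z M) := by
  induction M with
  | nil => exact continuous_const
  | cons i M ih =>
    rw [mon_cons]
    exact ((continuous_coord i).sub continuous_const).mul ih

lemma mul_mon_erase {M : List ℕ} {i : ℕ} (h : i ∈ M) (y : L2) :
    (y i - z i) * mon z (M.erase i) y = mon z M y :=
  List.prod_map_erase (fun i => y i - z i) h

lemma hasLineDerivAt_mon (M : List ℕ) (i : ℕ) (y : L2) :
    HasLineDerivAt ℝ (mon z M) (M.count i * mon z (M.erase i) y) y (e i) := by
  induction M with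
  | nil =>
    simp only [List.count_nil, Nat.cast_zero, zero_mul]
    exact hasDerivAt_const (0 : ℝ) (1 : ℝ)
  | cons k M ih =>
    have h1 : HasLineDerivAt ℝ (fun y : L2 => y k - z k) (if k = i then 1 else 0) y (e i) :=
      HasDerivAt.sub_const (z k) (hasLineDerivAt_coord k i y)
    have h2 := hasLineDerivAt_mul h1 ih
    rw [mon_cons]
    convert h2 using 1
    by_cases hk : k = i
    · subst hk
      rw [List.erase_cons_head, List.count_cons_self]
      by_cases hm : k ∈ M
      · rw [mul_left_comm, mul_mon_erase hm]
        push_cast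
        simp
        ring
      · simp [List.count_eq_zero_of_not_mem hm]
    · rw [List.erase_cons_tail (by simpa using hk), List.count_cons_of_ne hk]
      simp [mon, hk]
      ring

/-- The term `(κ, j, M)` stands for `κ · cutoff⁽ʲ⁾(∑ w_i (y_i - z_i)²) · ∏_{i ∈ M} (y_i - z_i)`. -/
noncomputable def tval (w : ℕ → ℝ) (z : L2) (t : ℝ × ℕ × List ℕ) (y : L2) : ℝ :=
  t.1 * (cutH w z t.2.1 y * mon z t.2.2 y)

/-- The two terms into which the `i`-th partial derivative of a term splits. -/
noncomputable def tder (w : ℕ → ℝ) (i : ℕ) (t : ℝ × ℕ × List ℕ) : List (ℝ × ℕ × List ℕ) :=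
  [(t.1 * (2 * w i), t.2.1 + 1, i :: t.2.2), (t.1 * t.2.2.count i, t.2.1, t.2.2.erase i)]

/-- The terms of the iterated partial derivatives of a bump. -/
noncomputable def terms (w : ℕ → ℝ) : List ℕ → List (ℝ × ℕ × List ℕ)
  | [] => [(1, 0, [])]
  | i :: l => (terms w l).flatMap (tder w i)

lemma fsmooth_bump_and_iterD (hw : ∀ i, 0 ≤ w i) (z : L2) : FSmooth univ (bump w z) ∧
    ∀ l, EqOn (iterD l (bump w z)) (fun y => ((terms w l).map fun t => tval w z t y).sum) univ := by
  refine FSmooth.of_family isOpen_univ (fun l y => ((terms w l).map fun t => tval w z t y).sum)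
    ?_ ?_ ?_ ?_
  · intro y _; simp [terms, tval, bump, mon]
  · intro l i y _
    have ht : ∀ t : ℝ × ℕ × List ℕ, HasLineDerivAt ℝ (tval w z t)
        (((tder w i t).map fun t => tval w z t y).sum) y (e i) := by
      intro t
      have h := HasDerivAt.const_mul t.1
        (hasLineDerivAt_mul (hasLineDerivAt_cutH (z := z) hw t.2.1 i y)
          (hasLineDerivAt_mon (z := z) t.2.2 i y))
      refine HasDerivAt.congr_deriv h ?_
      simp [tder, tval, mon]
      ring
    have h := hasLineDerivAt_list_sum (x := y) (v := e i) (terms w l) (tval w z) _ fun t _ => ht t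
    refine HasDerivAt.congr_deriv h ?_
    simp only [terms, List.map_flatMap]
    generalize terms w l = L
    induction L with
    | nil => rfl
    | cons t L ih => simp only [List.map_cons, List.sum_cons, List.flatMap_cons, List.sum_append, ih]
  · exact fun l => FContinuousOn.list_sum _ _ fun t _ =>
      (fContinuousOn_of_continuous continuous_const _).mul
        ((fContinuousOn_cutH hw _ _).mul (fContinuousOn_of_continuous (continuous_mon _) _))
  · exact fun l => (measurable_list_map_sum (terms w l) (tval w z) fun t _ =>
      measurable_const.mul ((measurable_cutH _).mul (continuous_mon _).measurable)).comp
        measurable_subtype_coe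

lemma length_terms (l : List ℕ) : (terms w l).length = 2 ^ l.length := by
  induction l with
  | nil => simp [terms]
  | cons i l ih =>
    have : ∀ L : List (ℝ × ℕ × List ℕ), (L.flatMap (tder w i)).length = L.length * 2 := by
      intro L
      induction L with
      | nil => rfl
      | cons t L ih => simp [tder, ih]; ring
    rw [terms, this, ih, List.length_cons, pow_succ]

lemma order_pos_of_mem_terms {l : List ℕ} (hl : l ≠ []) :
    ∀ t ∈ terms w l, t.1 = 0 ∨ 1 ≤ t.2.1 := by
  induction l with
  | nil => exact absurd rfl hl
  | cons i l ih =>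
    intro t ht
    obtain ⟨u, hu, htu⟩ := List.mem_flatMap.1 ht
    simp only [tder, List.mem_cons, List.not_mem_nil, or_false] at htu
    rcases htu with rfl | rfl
    · right; simp
    · rcases eq_or_ne l [] with rfl | hl'
      · simp only [terms, List.mem_singleton] at hu
        left; simp [hu]
      · rcases ih hl' u hu with h | h
        · left; simp [h]
        · right; exact h

/-- Where the quadratic form is less than `1`, all derivatives of the bump vanish. -/
lemma iterD_bump_eq_zero (hw : ∀ i, 0 ≤ w i) {y : L2} (hy : wq w z y < 1) {l : List ℕ}
    (hl : l ≠ []) : iterD l (bump w z) y = 0 := by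
  rw [(fsmooth_bump_and_iterD hw z).2 l (mem_univ y)]
  refine List.sum_eq_zero fun r hr => ?_
  obtain ⟨t, ht, rfl⟩ := List.mem_map.1 hr
  rcases order_pos_of_mem_terms hl t ht with h | h
  · simp [tval, h]
  · have htop : wq w z y ≠ ∞ := (hy.trans ENNReal.one_lt_top).ne
    have : cutH w z t.2.1 y = 0 := by
      rw [cutH, if_neg htop]
      refine cutoffD_eq_zero_of_lt_one ?_ h
      rw [← ENNReal.toReal_one]
      exact (ENNReal.toReal_lt_toReal htop ENNReal.one_ne_top).2 hy
    simp [tval, this]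

/-- Size of the coefficients when the weights are `s² c_i` with `s ≤ 1 ≤ c_i`: each coordinate in
the monomial is compensated by a factor `s`. -/
lemma coeff_le_of_mem_terms {c : ℕ → ℝ} (hc : ∀ i, 1 ≤ c i) {s : ℝ} (hs0 : 0 < s) (hs1 : s ≤ 1)
    (l : List ℕ) : ∀ t ∈ terms (fun i => s ^ 2 * c i) l, t.2.1 ≤ l.length ∧
      t.2.2.length ≤ l.length ∧
      |t.1| ≤ (l.length + 1).factorial * (l.map c).prod * s ^ t.2.2.length := by
  induction l with
  | nil => simp [terms]
  | cons i l ih =>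
    intro t ht
    obtain ⟨u, hu, htu⟩ := List.mem_flatMap.1 ht
    obtain ⟨h1, h2, h3⟩ := ih u hu
    have hP : 0 ≤ (l.map c).prod := List.prod_nonneg (by simp; intro a _; linarith [hc a])
    set F : ℝ := ((l.length + 1).factorial : ℝ) with hF
    have hF0 : 0 ≤ F := by positivity
    have hci := hc i
    have hFs : (((i :: l).length + 1).factorial : ℝ) = (l.length + 2) * F := by
      rw [List.length_cons, Nat.factorial_succ]; push_cast; ring
    simp only [tder, List.mem_cons, List.not_mem_nil, or_false] at htu
    rcases htu with rfl | rfl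
    · refine ⟨by simp; omega, by simp; omega, ?_⟩
      rw [hFs]
      simp only [List.map_cons, List.prod_cons, List.length_cons]
      rw [abs_mul, abs_of_nonneg (by positivity : (0 : ℝ) ≤ 2 * (s ^ 2 * c i))]
      calc |u.1| * (2 * (s ^ 2 * c i))
          ≤ F * (l.map c).prod * s ^ u.2.2.length * (2 * (s ^ 2 * c i)) := by gcongr
        _ = (2 * F * (c i * (l.map c).prod) * s ^ (u.2.2.length + 1)) * s := by ring
        _ ≤ (2 * F * (c i * (l.map c).prod) * s ^ (u.2.2.length + 1)) * 1 := by gcongr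
        _ = 2 * (F * (c i * (l.map c).prod) * s ^ (u.2.2.length + 1)) := by ring
        _ ≤ (l.length + 2) * (F * (c i * (l.map c).prod) * s ^ (u.2.2.length + 1)) := by
          gcongr; linarith [(Nat.cast_nonneg l.length : (0 : ℝ) ≤ l.length)]
        _ = _ := by ring
    · refine ⟨by simp; omega, ?_, ?_⟩
      · simp only [List.length_cons]
        exact (List.length_erase_le).trans (by omega)
      rw [hFs]
      simp only [List.map_cons, List.prod_cons]
      by_cases hm : i ∈ u.2.2
      · obtain ⟨n, hn⟩ : ∃ n, u.2.2.length = n + 1 :=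
          ⟨u.2.2.length - 1, by have := List.length_pos_of_mem hm; omega⟩
        rw [List.length_erase_of_mem hm, hn, Nat.add_sub_cancel, abs_mul,
          Nat.abs_cast]
        rw [hn] at h3
        have hcount : ((u.2.2.count i : ℕ) : ℝ) ≤ l.length + 2 := by
          have : u.2.2.count i ≤ l.length + 2 := (List.count_le_length).trans (by omega)
          exact_mod_cast this
        calc |u.1| * (u.2.2.count i : ℝ)
            ≤ F * (l.map c).prod * s ^ (n + 1) * (l.length + 2) := by gcongr
          _ = ((l.length + 2) * F * (l.map c).prod * s ^ n) * s * 1 := by ring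
          _ ≤ ((l.length + 2) * F * (l.map c).prod * s ^ n) * 1 * c i := by gcongr
          _ = _ := by ring
      · rw [List.count_eq_zero_of_not_mem hm]
        simp only [Nat.cast_zero, mul_zero, abs_zero]
        positivity

lemma abs_list_sum_le {ι : Type*} (L : List ι) (F : ι → ℝ) {B : ℝ} (h : ∀ t ∈ L, |F t| ≤ B) :
    |(L.map F).sum| ≤ L.length * B := by
  induction L with
  | nil => simp
  | cons t L ih =>
    simp only [List.map_cons, List.sum_cons, List.length_cons]
    have h1 := h t (by simp)
    have h2 := ih fun u hu => h u (by simp [hu])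
    push_cast
    linarith [abs_add_le (F t) (L.map F).sum]

/-- Bounds for the derivatives of the bumps, uniform in the scale `s ≤ 1` and in the centre. -/
lemma exists_iterD_bump_le {c : ℕ → ℝ} (hc : ∀ i, 1 ≤ c i) : ∃ K : ℕ → ℝ,
    ∀ s : ℝ, 0 < s → s ≤ 1 → ∀ (z y : L2) (l : List ℕ),
      |iterD l (bump (fun i => s ^ 2 * c i) z) y| ≤ K l.length * (l.map c).prod := by
  choose B hB0 hB using exists_cutoffD_le
  refine ⟨fun k => 2 ^ k * ((k + 1).factorial * 2 ^ k * B k), fun s hs0 hs1 z y l => ?_⟩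
  have hw : ∀ i, 0 ≤ s ^ 2 * c i := fun i => by have := hc i; positivity
  have hP : 0 ≤ (l.map c).prod := List.prod_nonneg (by simp; intro a _; linarith [hc a])
  rw [(fsmooth_bump_and_iterD hw z).2 l (mem_univ y)]
  refine (abs_list_sum_le _ (fun t => tval (fun i => s ^ 2 * c i) z t y)
    (B := (l.length + 1).factorial * 2 ^ l.length * B l.length * (l.map c).prod)
    fun t ht => ?_).trans_eq ?_
  · obtain ⟨h1, h2, h3⟩ := coeff_le_of_mem_terms hc hs0 hs1 l t ht
    have hB' := hB0 l.length
    by_cases hz : cutH (fun i => s ^ 2 * c i) z t.2.1 y = 0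
    · simp only [tval, hz, zero_mul, mul_zero, abs_zero]
      positivity
    have hwq := wq_le_of_cutH_ne_zero hz
    have htop : wq (fun i => s ^ 2 * c i) z y ≠ ∞ := (hwq.trans_lt (by norm_num)).ne
    have hcut : |cutH (fun i => s ^ 2 * c i) z t.2.1 y| ≤ B l.length := by
      rw [cutH, if_neg htop]
      exact hB _ _ h1 _ ENNReal.toReal_nonneg
    have hcoord : ∀ i, |y i - z i| ≤ 2 / s := by
      intro i
      have h4 : ENNReal.ofReal (s ^ 2 * c i * (y i - z i) ^ 2) ≤ ENNReal.ofReal 2 := by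
        refine (ENNReal.le_tsum (f := fun i => ENNReal.ofReal (s ^ 2 * c i * (y i - z i) ^ 2))
          i).trans (hwq.trans_eq (by norm_num))
      have h5 := (ENNReal.ofReal_le_ofReal_iff two_pos.le).1 h4
      have h6 : s ^ 2 * (y i - z i) ^ 2 ≤ s ^ 2 * c i * (y i - z i) ^ 2 := by
        have := hc i
        calc s ^ 2 * (y i - z i) ^ 2 = s ^ 2 * 1 * (y i - z i) ^ 2 := by ring
          _ ≤ _ := by gcongr
      rw [le_div_iff₀ hs0]
      refine (sq_le_sq₀ (by positivity) two_pos.le).1 ?_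
      rw [mul_pow, sq_abs]
      linarith
    have hmon : |mon z t.2.2 y| ≤ (2 / s) ^ t.2.2.length := by
      generalize t.2.2 = M
      induction M with
      | nil => simp [mon]
      | cons i M ih =>
        rw [mon_cons, abs_mul, List.length_cons, pow_succ']
        exact mul_le_mul (hcoord i) ih (abs_nonneg _) (by positivity)
    rw [tval, abs_mul, abs_mul]
    calc |t.1| * (|cutH (fun i => s ^ 2 * c i) z t.2.1 y| * |mon z t.2.2 y|)
        ≤ ((l.length + 1).factorial * (l.map c).prod * s ^ t.2.2.length) *
          (B l.length * (2 / s) ^ t.2.2.length) := by gcongr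
      _ = (l.length + 1).factorial * (l.map c).prod * B l.length *
          (s ^ t.2.2.length * (2 / s) ^ t.2.2.length) := by ring
      _ = (l.length + 1).factorial * (l.map c).prod * B l.length * 2 ^ t.2.2.length := by
          rw [← mul_pow, mul_div_cancel₀ _ hs0.ne']
      _ ≤ (l.length + 1).factorial * (l.map c).prod * B l.length * 2 ^ l.length := by
          gcongr; norm_num
      _ = _ := by ring
  · rw [length_terms]; push_cast; ring

end Bump

/-! ### Bumps are test functions -/

lemma ofReal_norm_sq (x : L2) : ENNReal.ofReal (‖x‖ ^ 2) = ∑' i, ENNReal.ofReal (x i ^ 2) := by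
  have h := lp.hasSum_norm (E := fun _ : ℕ => ℝ) (p := 2) (by norm_num) x
  simp only [ENNReal.toReal_ofNat, Real.rpow_ofNat, Real.norm_eq_abs, sq_abs] at h
  rw [← h.tsum_eq, ENNReal.ofReal_tsum_of_nonneg (fun i => sq_nonneg _) h.summable]

lemma norm_sub_le_of_wq_le {w : ℕ → ℝ} {κ : ℝ} (hκ : 0 < κ) (hw : ∀ i, κ ^ 2 ≤ w i) {z y : L2}
    (h : wq w z y ≤ 2) : ‖y - z‖ ≤ 2 / κ := by
  have h1 : ENNReal.ofReal (κ ^ 2 * ‖y - z‖ ^ 2) ≤ ENNReal.ofReal 2 := by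
    rw [ENNReal.ofReal_mul (by positivity), ofReal_norm_sq, ← ENNReal.tsum_mul_left]
    refine le_trans (ENNReal.tsum_le_tsum fun i => ?_) (h.trans_eq (by norm_num))
    rw [← ENNReal.ofReal_mul (by positivity), lp.coeFn_sub, Pi.sub_apply]
    exact ENNReal.ofReal_le_ofReal (mul_le_mul_of_nonneg_right (hw i) (sq_nonneg _))
  have h2 := (ENNReal.ofReal_le_ofReal_iff two_pos.le).1 h1
  rw [le_div_iff₀ hκ]
  refine (sq_le_sq₀ (by positivity) two_pos.le).1 ?_
  rw [mul_pow]
  linarith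

section

variable {a : ℕ → ℝ}

lemma qb_bump (ha : ∀ i, 0 < a i) {c : ℕ → ℝ} (hc : ∀ i, 1 ≤ c i)
    (hs : Summable fun i => a i * c i) {s : ℝ} (hs0 : 0 < s) (hs1 : s ≤ 1) (z : L2) :
    QB a univ (bump (fun i => s ^ 2 * c i) z) := by
  obtain ⟨K, hK⟩ := exists_iterD_bump_le hc
  have hc0 : ∀ i, 0 ≤ c i := fun i => zero_le_one.trans (hc i)
  exact qb_of_le ha hc0
    (tsum_ofReal_rpow_lt_top (fun i => mul_nonneg (ha i).le (hc0 i)) hs one_le_two) K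
    fun x _ l => hK s hs0 hs1 z x l

lemma fsmooth_bump {c : ℕ → ℝ} (hc : ∀ i, 1 ≤ c i) (s : ℝ) (z : L2) :
    FSmooth univ (bump (fun i => s ^ 2 * c i) z) :=
  (fsmooth_bump_and_iterD (fun i => mul_nonneg (sq_nonneg s) (zero_le_one.trans (hc i))) z).1

lemma isTest_bump (ha : ∀ i, 0 < a i) {c : ℕ → ℝ} (hc : ∀ i, 1 ≤ c i)
    (hs : Summable fun i => a i * c i) {s : ℝ} (hs0 : 0 < s) (hs1 : s ≤ 1) (z : L2) :
    IsTest a univ (bump (fun i => s ^ 2 * c i) z) := by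
  rw [isTest_iff ha isOpen_univ]
  refine ⟨fsmooth_bump hc s z, qb_bump ha hc hs hs0 hs1 z, 1, ‖z‖ + 2 / s + 1, one_pos,
    by positivity, subset_univ _, ?_⟩
  rintro y ⟨-, hy⟩
  have h1 := norm_sub_le_of_wq_le hs0
    (fun i => le_mul_of_one_le_right (sq_nonneg s) (hc i)) (wq_le_of_cutH_ne_zero hy)
  rw [mem_ball_zero_iff]
  linarith [norm_le_norm_sub_add y z]

/-- A bump with constant weights `κ²` is a function of the distance to its centre; for large `κ` it
is supported well inside `O`. -/
lemma exists_local_bump (ha : ∀ i, 0 < a i) (has : Summable a) {O : Set L2} (hO : IsOpen O)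
    {z : L2} (hz : z ∈ O) : ∃ φ : L2 → ℝ, IsTest a O φ ∧ ∀ᶠ y in 𝓝 z, φ y = 1 := by
  obtain ⟨ρ, hρ, hball⟩ := Metric.isOpen_iff.1 hO z hz
  set κ : ℝ := max 1 (4 / ρ) with hκ
  have hκ1 : 1 ≤ κ := le_max_left _ _
  have hκ0 : 0 < κ := by linarith
  have hκρ : 2 / κ ≤ ρ / 2 := by
    have : 4 / ρ ≤ κ := le_max_right _ _
    rw [div_le_iff₀ hρ] at this
    rw [div_le_div_iff₀ hκ0 two_pos]
    linarith
  have hc : ∀ i : ℕ, 1 ≤ (fun _ => κ ^ 2 : ℕ → ℝ) i := fun _ => one_le_pow₀ hκ1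
  refine ⟨bump (fun i => 1 ^ 2 * (fun _ => κ ^ 2 : ℕ → ℝ) i) z, ?_, ?_⟩
  · rw [isTest_iff ha hO]
    refine ⟨(fsmooth_bump hc 1 z).mono (subset_univ O),
      (qb_bump ha hc (has.mul_right _) one_pos le_rfl z).mono (subset_univ O), ρ / 2, ‖z‖ + ρ,
      by positivity, by positivity, ?_, ?_⟩
    all_goals
      have key : ∀ y, bump (fun i => 1 ^ 2 * (fun _ => κ ^ 2 : ℕ → ℝ) i) z y ≠ 0 →
          ‖y - z‖ ≤ ρ / 2 := fun y hy =>
        (norm_sub_le_of_wq_le hκ0 (fun i => by simp) (wq_le_of_cutH_ne_zero hy)).trans hκρ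
    · simp only [iUnion_subset_iff]
      rintro y ⟨-, hy⟩
      refine (Metric.ball_subset_ball' ?_).trans hball
      rw [dist_eq_norm]
      linarith [key y hy]
    · rintro y ⟨-, hy⟩
      rw [mem_ball_zero_iff]
      linarith [key y hy, norm_le_norm_sub_add y z]
  · filter_upwards [Metric.ball_mem_nhds z (inv_pos.2 hκ0)] with y hy
    refine bump_eq_one ?_
    have h1 : wq (fun i => 1 ^ 2 * (fun _ => κ ^ 2 : ℕ → ℝ) i) z y =
        ENNReal.ofReal (κ ^ 2 * ‖y - z‖ ^ 2) := by
      rw [ENNReal.ofReal_mul (by positivity), ofReal_norm_sq, ← ENNReal.tsum_mul_left, wq]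
      refine tsum_congr fun i => ?_
      rw [← ENNReal.ofReal_mul (by positivity), lp.coeFn_sub, Pi.sub_apply, one_pow, one_mul]
    rw [h1, ← ENNReal.ofReal_one, ← mul_pow]
    refine ENNReal.ofReal_le_ofReal (pow_le_one₀ (by positivity) ?_)
    rw [Metric.mem_ball, dist_eq_norm] at hy
    rw [← mul_inv_cancel₀ hκ0.ne']
    gcongr

/-! ### Uniqueness of weak derivatives -/

lemma inner_e (ξ : L2) (i : ℕ) : inner ℝ ξ (e i) = ξ i := by
  rw [e, lp.inner_single_right]
  simp

/-- Each derivative of `cos (⟨ξ, x⟩ + θ)` along `e_i` brings out `ξ_i` and shifts the phase by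
`π / 2`. -/
lemma multiplier_cos (ha : ∀ i, 0 < a i) (has : Summable a) (ξ : L2) (θ : ℝ) :
    Multiplier a fun x => Real.cos (inner ℝ ξ x + θ) := by
  let G : List ℕ → L2 → ℝ := fun l x =>
    (l.map fun i => ξ i).prod * Real.cos (inner ℝ ξ x + (θ + l.length * (Real.pi / 2)))
  have hG : ∀ l, Continuous (G l) := fun l => by fun_prop
  obtain ⟨h1, h2⟩ := FSmooth.of_family (f := fun x => Real.cos (inner ℝ ξ x + θ)) isOpen_univ G
    (fun x _ => by simp [G]) (by
      intro l i x _
      have hin : HasDerivAt (fun t : ℝ => inner ℝ ξ (x + t • e i) +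
          (θ + l.length * (Real.pi / 2))) (ξ i) 0 := by
        have : (fun t : ℝ => inner ℝ ξ (x + t • e i) + (θ + l.length * (Real.pi / 2))) =
            fun t : ℝ => inner ℝ ξ x + t * ξ i + (θ + l.length * (Real.pi / 2)) := by
          ext t
          rw [inner_add_right, inner_smul_right, inner_e]
        rw [this]
        simpa using (((hasDerivAt_id (0 : ℝ)).mul_const (ξ i)).const_add (inner ℝ ξ x)).add_const
          (θ + l.length * (Real.pi / 2))
      have h := (hin.cos).const_mul (l.map fun i => ξ i).prod
      refine HasDerivAt.congr_deriv h ?_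
      simp only [G, zero_smul, add_zero, List.map_cons, List.prod_cons, List.length_cons]
      have : inner ℝ ξ x + (θ + ((l.length + 1 : ℕ) : ℝ) * (Real.pi / 2)) =
          inner ℝ ξ x + (θ + l.length * (Real.pi / 2)) + Real.pi / 2 := by push_cast; ring
      rw [this, Real.cos_add_pi_div_two]
      ring)
    (fun l => fContinuousOn_of_continuous (hG l) _)
    (fun l => (hG l).measurable.comp measurable_subtype_coe)
  refine ⟨h1, fun R => qb_of_le ha (w := fun i => |ξ i|) (fun i => abs_nonneg _) ?_ (fun _ => 1)
    fun x _ l => ?_⟩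
  · refine tsum_ofReal_rpow_lt_top (fun i => mul_nonneg (ha i).le (abs_nonneg _)) ?_ one_le_two
    exact Summable.of_nonneg_of_le (fun i => mul_nonneg (ha i).le (abs_nonneg _))
      (fun i => mul_le_mul_of_nonneg_left (abs_coord_le ξ i) (ha i).le) (has.mul_right ‖ξ‖)
  · rw [h2 l (mem_univ x)]
    have h3 : |(l.map fun i => ξ i).prod| = (l.map fun i => |ξ i|).prod := by
      clear h1 h2
      induction l with
      | nil => simp
      | cons i l ih => simp [abs_mul, ih]
    simp only [G]
    rw [abs_mul, h3, one_mul]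
    exact mul_le_of_le_one_right (List.prod_nonneg (by simp)) (Real.abs_cos_le_one _)

/-- An integrable function whose Fourier transform vanishes is zero almost everywhere. -/
lemma ae_eq_zero_of_forall_integral_cos {μ : Measure L2} {h : L2 → ℝ} (hint : Integrable h μ)
    (hz : ∀ (ξ : L2) (θ : ℝ), ∫ x, h x * Real.cos (inner ℝ ξ x + θ) ∂μ = 0) : h =ᵐ[μ] 0 := by
  have hm := hint.aestronglyMeasurable.aemeasurable
  have hfin : ∀ g : L2 → ℝ, Integrable g μ →
      IsFiniteMeasure (μ.withDensity fun x => ENNReal.ofReal (g x)) := fun g hg =>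
    isFiniteMeasure_withDensity_ofReal hg.2
  have := hfin h hint
  have := hfin (fun x => -h x) hint.neg
  have hexp : ∀ ξ : L2, Continuous fun x : L2 => Complex.exp (inner ℝ x ξ * Complex.I) :=
    fun ξ => by fun_prop
  have hexpn : ∀ ξ x : L2, ‖Complex.exp (inner ℝ x ξ * Complex.I)‖ ≤ 1 := fun ξ x =>
    (Complex.norm_exp_ofReal_mul_I _).le
  have hI : ∀ g : L2 → ℝ, Integrable g μ → ∀ ξ : L2,
      Integrable (fun x => (g x : ℂ) * Complex.exp (inner ℝ x ξ * Complex.I)) μ := fun g hg ξ =>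
    hg.ofReal.mul_bdd (c := 1) (hexp ξ).aestronglyMeasurable (Eventually.of_forall (hexpn ξ))
  have hcf : ∀ g : L2 → ℝ, Integrable g μ → ∀ ξ : L2,
      charFun (μ.withDensity fun x => ENNReal.ofReal (g x)) ξ =
        ∫ x, ((max (g x) 0 : ℝ) : ℂ) * Complex.exp (inner ℝ x ξ * Complex.I) ∂μ := by
    intro g hg ξ
    rw [charFun_apply]
    have := integral_withDensity_eq_integral_smul₀ (μ := μ) (f := fun x => (g x).toNNReal)
      hg.aestronglyMeasurable.aemeasurable.real_toNNReal
      (fun x : L2 => Complex.exp (inner ℝ x ξ * Complex.I))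
    refine this.trans (integral_congr_ae (Eventually.of_forall fun x => ?_))
    simp only [NNReal.smul_def, Real.coe_toNNReal', Complex.real_smul]
  have hfour : ∀ ξ : L2, ∫ x, (h x : ℂ) * Complex.exp (inner ℝ x ξ * Complex.I) ∂μ = 0 := by
    intro ξ
    have hc : ∀ θ : ℝ, Integrable (fun x => h x * Real.cos (inner ℝ ξ x + θ)) μ := fun θ =>
      hint.mul_bdd (c := 1) (by fun_prop : Continuous fun x : L2 =>
        Real.cos (inner ℝ ξ x + θ)).aestronglyMeasurable
        (Eventually.of_forall fun x => Real.abs_cos_le_one _)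
    have hsplit : (fun x => (h x : ℂ) * Complex.exp (inner ℝ x ξ * Complex.I)) = fun x =>
        ((h x * Real.cos (inner ℝ ξ x + 0) : ℝ) : ℂ) +
          ((h x * Real.cos (inner ℝ ξ x + -(Real.pi / 2)) : ℝ) : ℂ) * Complex.I := by
      ext x
      rw [Complex.exp_mul_I, real_inner_comm, add_zero, ← sub_eq_add_neg, Real.cos_sub_pi_div_two]
      push_cast
      ring
    rw [hsplit, integral_add (hc 0).ofReal ((hc _).ofReal.mul_const _), integral_mul_const,
      integral_complex_ofReal, integral_complex_ofReal, hz, hz]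
    simp
  -- the positive and negative parts of `h` are densities of measures with the same transform
  have heq : (μ.withDensity fun x => ENNReal.ofReal (h x)) =
      μ.withDensity fun x => ENNReal.ofReal (-h x) := by
    refine Measure.ext_of_charFun (funext fun ξ => ?_)
    rw [hcf h hint, hcf (fun x => -h x) hint.neg, ← sub_eq_zero,
      ← integral_sub (hI _ hint.pos_part ξ) (hI _ hint.neg_part ξ), ← hfour ξ]
    refine integral_congr_ae (Eventually.of_forall fun x => ?_)
    simp only
    rw [← sub_mul, ← Complex.ofReal_sub, max_zero_sub_max_neg_zero_eq_self]
  have hae := (withDensity_eq_iff hm.ennreal_ofReal (hm.neg).ennreal_ofReal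
    (hint.lintegral_lt_top).ne).1 heq
  filter_upwards [hae] with x hx
  rw [Pi.neg_apply] at hx
  rcases lt_trichotomy (h x) 0 with hlt | h0 | hgt
  · rw [ENNReal.ofReal_of_nonpos hlt.le, eq_comm, ENNReal.ofReal_eq_zero] at hx
    simp only [Pi.zero_apply]; linarith
  · exact h0
  · rw [ENNReal.ofReal_of_nonpos (by linarith : -h x ≤ 0), ENNReal.ofReal_eq_zero] at hx
    simp only [Pi.zero_apply]; linarith

/-- Test functions separate integrable functions: a local bump times a trigonometric function is
a test function, and the Fourier transform is injective. -/
lemma ae_eq_zero_of_forall_isTest (ha : ∀ i, 0 < a i) (has : Summable a) {O : Set L2}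
    (hO : IsOpen O) {g : L2 → ℝ} (hg : Integrable g ((P a).restrict O))
    (h : ∀ φ, IsTest a O φ → ∫ x in O, g x * φ x ∂(P a) = 0) : g =ᵐ[(P a).restrict O] 0 := by
  -- locally, `g φ` has vanishing Fourier transform for every test function `φ`
  have hloc : ∀ φ, IsTest a O φ → (fun x => g x * φ x) =ᵐ[(P a).restrict O] 0 := by
    intro φ hφ
    refine ae_eq_zero_of_forall_integral_cos (IsTest.integrable_mul ha hO hg hφ) fun ξ θ => ?_
    rw [← h _ (IsTest.mul_left ha hO (multiplier_cos ha has ξ θ) hφ)]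
    congr 1; ext x; ring
  have hnull : (P a).restrict O {x | x ∈ O ∧ g x ≠ 0} = 0 := by
    refine measure_null_of_locally_null _ fun z hz => ?_
    obtain ⟨φ, hφ, hφ1⟩ := exists_local_bump ha has hO hz.1
    refine ⟨{x | x ∈ O ∧ g x ≠ 0} ∩ {y | φ y = 1},
      inter_mem self_mem_nhdsWithin (mem_nhdsWithin_of_mem_nhds hφ1), ?_⟩
    refine measure_mono_null ?_ (ae_iff.1 (hloc φ hφ))
    rintro y ⟨⟨-, hy⟩, hy1⟩
    simp only [mem_ofPred_eq] at hy1
    simpa [hy1] using hy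
  filter_upwards [ae_restrict_mem hO.measurableSet, measure_eq_zero_iff_ae_notMem.1 hnull]
    with x hx hx'
  by_contra hne
  exact hx' ⟨hx, hne⟩

lemma IsWeakDeriv.ae_eq (ha : ∀ i, 0 < a i) (has : Summable a) {p : ℝ} (hp : 1 ≤ p) {O : Set L2}
    (hO : IsOpen O) {l : List ℕ} {f g g' : L2 → ℝ} (h : IsWeakDeriv a p O l f g)
    (h' : IsWeakDeriv a p O l f g') : g =ᵐ[(P a).restrict O] g' := by
  have h1 := integrable_of_memLp hp h.1
  have h2 := integrable_of_memLp hp h'.1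
  have := ae_eq_zero_of_forall_isTest ha has hO (g := fun x => g x - g' x) (h1.sub h2) (by
    intro φ hφ
    simp only [sub_mul]
    rw [integral_sub (IsTest.integrable_mul ha hO h1 hφ) (IsTest.integrable_mul ha hO h2 hφ),
      h.2 φ hφ, h'.2 φ hφ, sub_self])
  filter_upwards [this] with x hx
  simpa [sub_eq_zero] using hx

lemma isWeakDeriv_weakDeriv {p : ℝ} {O : Set L2} {l : List ℕ} {f : L2 → ℝ}
    (h : ∃ g, IsWeakDeriv a p O l f g) : IsWeakDeriv a p O l f (weakDeriv a p O l f) := by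
  rw [weakDeriv, dif_pos h]
  exact Classical.choose_spec h

end

/-! ### Existence of compactly truncated sequences -/

/-- Weights tending to infinity against which a given convergent series still converges: the
inverse square roots of the tails of the series. -/
lemma exists_weights {a : ℕ → ℝ} (ha : ∀ i, 0 < a i) (has : Summable a) (hlt : ∑' i, a i < 1) :
    ∃ c : ℕ → ℝ, (∀ i, 1 ≤ c i) ∧ Tendsto c atTop atTop ∧ Summable fun i => a i * c i := by
  set t : ℕ → ℝ := fun i => ∑' j, a (j + i) with ht
  have hts : ∀ i, Summable fun j => a (j + i) := fun i => (summable_nat_add_iff i).2 has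
  have hpos : ∀ i, 0 < t i := fun i => (hts i).tsum_pos (fun j => (ha _).le) 0 (ha _)
  have hstep : ∀ i, t i = a i + t (i + 1) := by
    intro i
    have := (hts i).tsum_eq_zero_add
    simp only [zero_add] at this
    rw [ht]
    simp only
    rw [this]
    congr 1
    exact tsum_congr fun j => by congr 1; ring
  have hle1 : ∀ i, t i ≤ 1 := by
    intro i
    induction i with
    | zero => simpa [ht] using hlt.le
    | succ i ih => linarith [hstep i, ha i]
  have htend : Tendsto t atTop (𝓝 0) := tendsto_sum_nat_add a
  refine ⟨fun i => (√(t i))⁻¹, fun i => ?_, ?_, ?_⟩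
  · exact (one_le_inv₀ (Real.sqrt_pos.2 (hpos i))).2 (Real.sqrt_le_one.2 (hle1 i))
  · refine Tendsto.inv_tendsto_nhdsGT_zero (tendsto_nhdsWithin_iff.2 ⟨?_, ?_⟩)
    · simpa using htend.sqrt
    · exact Eventually.of_forall fun i => Real.sqrt_pos.2 (hpos i)
  · refine summable_of_sum_range_le (c := 2 * √(t 0))
      (fun i => mul_nonneg (ha i).le (inv_nonneg.2 (Real.sqrt_nonneg _))) fun n => ?_
    -- telescoping: `a i / √(t i) ≤ 2 (√(t i) - √(t (i + 1)))`
    have hterm : ∀ i, a i * (√(t i))⁻¹ ≤ 2 * √(t i) - 2 * √(t (i + 1)) := by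
      intro i
      have h0 := Real.sqrt_pos.2 (hpos i)
      have h1 := Real.sq_sqrt (hpos i).le
      have h2 := Real.sq_sqrt (hpos (i + 1)).le
      rw [← div_eq_mul_inv, div_le_iff₀ h0]
      nlinarith [hstep i, sq_nonneg (√(t i) - √(t (i + 1)))]
    calc ∑ i ∈ Finset.range n, a i * (√(t i))⁻¹
        ≤ ∑ i ∈ Finset.range n, (2 * √(t i) - 2 * √(t (i + 1))) :=
          Finset.sum_le_sum fun i _ => hterm i
      _ = 2 * √(t 0) - 2 * √(t n) := Finset.sum_range_sub' (fun i => 2 * √(t i)) n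
      _ ≤ 2 * √(t 0) := by linarith [Real.sqrt_nonneg (t n)]

/-- Ellipsoids whose semi-axes tend to zero are relatively compact in `ℓ²`. -/
lemma exists_isCompact_superset {c : ℕ → ℝ} (hc : ∀ i, 1 ≤ c i) (hct : Tendsto c atTop atTop)
    {R : ℝ} (hR : 0 < R) : ∃ K : Set L2, IsCompact K ∧
      {y : L2 | ∑' i, ENNReal.ofReal (c i * y i ^ 2) ≤ ENNReal.ofReal R} ⊆ K := by
  set S := {y : L2 | ∑' i, ENNReal.ofReal (c i * y i ^ 2) ≤ ENNReal.ofReal R} with hS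
  suffices h : TotallyBounded S from
    ⟨closure S, h.closure.isCompact_of_isClosed isClosed_closure, subset_closure⟩
  rw [Metric.totallyBounded_iff]
  intro ε hε
  -- beyond the coordinate `N` the points of `S` have tails of norm at most `ε / 4`; the first `N`
  -- coordinates range over a compact box
  obtain ⟨N, hN⟩ := eventually_atTop.1 (hct.eventually_ge_atTop (16 * R / ε ^ 2))
  let T : (Fin N → ℝ) → L2 := fun s => ∑ j, s j • e j
  have hT : Continuous T := by fun_prop
  have hbox : IsCompact (T '' Icc (fun _ => -√R) fun _ => √R) := isCompact_Icc.image hT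
  obtain ⟨t, htf, ht⟩ := Metric.totallyBounded_iff.1 hbox.totallyBounded (ε / 2) (by positivity)
  refine ⟨t, htf, fun y hy => ?_⟩
  have hcoord : ∀ i, |y i| ≤ √R := by
    intro i
    have h1 := (ENNReal.ofReal_le_ofReal_iff hR.le).1
      ((ENNReal.le_tsum (f := fun i => ENNReal.ofReal (c i * y i ^ 2)) i).trans hy)
    refine Real.abs_le_sqrt (le_trans ?_ h1)
    exact le_mul_of_one_le_left (sq_nonneg _) (hc i)
  have hTi : ∀ i, (y - T fun j => y j : L2) i = if i < N then 0 else y i := by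
    intro i
    rw [lp.coeFn_sub, Pi.sub_apply]
    simp only [T]
    rw [coe_sum_smul_e]
    by_cases hi : i < N
    · rw [if_pos hi, Finset.sum_eq_single (⟨i, hi⟩ : Fin N)]
      · simp
      · intro j _ hj
        rw [if_neg fun h => hj (Fin.ext h.symm), mul_zero]
      · simp
    · rw [if_neg hi, Finset.sum_eq_zero, sub_zero]
      intro j _
      rw [if_neg (by omega), mul_zero]
  have hnorm : ‖y - T fun j => y j‖ ≤ ε / 4 := by
    have h1 : ENNReal.ofReal (‖y - T fun j => y j‖ ^ 2) ≤ ENNReal.ofReal ((ε / 4) ^ 2) := by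
      calc ENNReal.ofReal (‖y - T fun j => y j‖ ^ 2)
          = ∑' i, ENNReal.ofReal ((y - T fun j => y j : L2) i ^ 2) := ofReal_norm_sq _
        _ ≤ ∑' i, ENNReal.ofReal (ε ^ 2 / (16 * R)) * ENNReal.ofReal (c i * y i ^ 2) := by
            refine ENNReal.tsum_le_tsum fun i => ?_
            rw [hTi, ← ENNReal.ofReal_mul (by positivity)]
            refine ENNReal.ofReal_le_ofReal ?_
            have hci := hc i
            split_ifs with hi
            · rw [zero_pow two_ne_zero]; positivity
            · have h2 := hN i (by omega)
              rw [div_le_iff₀ (by positivity)] at h2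
              have h3 : 1 ≤ ε ^ 2 / (16 * R) * c i := by
                rw [div_mul_eq_mul_div, one_le_div (by positivity)]
                linarith
              rw [← mul_assoc]
              exact le_mul_of_one_le_left (sq_nonneg _) h3
        _ ≤ ENNReal.ofReal (ε ^ 2 / (16 * R)) * ENNReal.ofReal R := by
            rw [ENNReal.tsum_mul_left]
            exact mul_le_mul_right hy _
        _ = ENNReal.ofReal ((ε / 4) ^ 2) := by
            rw [← ENNReal.ofReal_mul (by positivity)]
            congr 1
            field_simp
            norm_num
    exact (sq_le_sq₀ (norm_nonneg _) (by positivity)).1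
      ((ENNReal.ofReal_le_ofReal_iff (by positivity)).1 h1)
  have hmem : T (fun j => y j) ∈ T '' Icc (fun _ => -√R) fun _ => √R :=
    mem_image_of_mem _ ⟨fun j => (abs_le.1 (hcoord j)).1, fun j => (abs_le.1 (hcoord j)).2⟩
  have h3 := ht hmem
  simp only [mem_iUnion, Metric.mem_ball] at h3 ⊢
  obtain ⟨u, hu, hdist⟩ := h3
  refine ⟨u, hu, ?_⟩
  have h4 := dist_triangle y (T fun j => y j) u
  rw [← dist_eq_norm] at hnorm
  linarith

/-- The truncations are bumps `cutoff ((n + 1)⁻¹ ∑ c_i x_i²)` with weights `c_i → ∞`. -/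
lemma exists_isCompactlyTruncated {a : ℕ → ℝ} (ha : ∀ i, 0 < a i) (has : Summable a)
    (hlt : ∑' i, a i < 1) {p : ℝ} (hp : 1 ≤ p) : ∃ X, IsCompactlyTruncated a p X := by
  obtain ⟨c, hc, hct, hsum⟩ := exists_weights ha has hlt
  have hc0 : ∀ i, 0 ≤ c i := fun i => zero_le_one.trans (hc i)
  -- the scale enters the bumps through its square
  let s : ℕ → ℝ := fun n => (√((n : ℝ) + 1))⁻¹
  have hs0 : ∀ n, 0 < s n := fun n => inv_pos.2 (Real.sqrt_pos.2 (by positivity))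
  have hs1 : ∀ n, s n ≤ 1 := fun n => inv_le_one_of_one_le₀ (Real.one_le_sqrt.2 (by simp))
  have hs2 : ∀ n, s n ^ 2 = ((n : ℝ) + 1)⁻¹ := fun n => by
    rw [inv_pow, Real.sq_sqrt (by positivity)]
  have hwq : ∀ n y, wq (fun i => s n ^ 2 * c i) 0 y =
      ENNReal.ofReal (((n : ℝ) + 1)⁻¹) * ∑' i, ENNReal.ofReal (c i * y i ^ 2) := by
    intro n y
    rw [wq, ← ENNReal.tsum_mul_left]
    refine tsum_congr fun i => ?_
    rw [← ENNReal.ofReal_mul (by positivity), hs2]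
    congr 1
    simp only [lp.coeFn_zero, Pi.zero_apply, sub_zero]
    ring
  -- almost every point eventually lies where the truncation is locally constant along the axes
  have hae : ∀ᵐ x ∂(P a), ∀ᶠ n in atTop, wq (fun i => s n ^ 2 * c i) 0 x < 1 := by
    have hfin : ∑' i, ENNReal.ofReal (c i * a i ^ 2) < ∞ := by
      have h1 : ∀ i, a i ≤ 1 := fun i => (has.le_tsum i fun j _ => (ha j).le).trans hlt.le
      have h2 := tsum_ofReal_rpow_lt_top (fun i => mul_nonneg (ha i).le (hc0 i)) hsum le_rfl
      simp only [ENNReal.rpow_one] at h2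
      refine lt_of_le_of_lt (ENNReal.tsum_le_tsum fun i => ENNReal.ofReal_le_ofReal ?_) h2
      have := mul_le_mul_of_nonneg_left (h1 i) (mul_nonneg (ha i).le (hc0 i))
      nlinarith
    filter_upwards [ae_tsum_lt_top hc0 hfin] with x hx
    have hlim : Tendsto (fun n : ℕ => ENNReal.ofReal (((n : ℝ) + 1)⁻¹) *
        ∑' i, ENNReal.ofReal (c i * x i ^ 2)) atTop (𝓝 0) := by
      have h1 : Tendsto (fun n : ℕ => ENNReal.ofReal (((n : ℝ) + 1)⁻¹)) atTop (𝓝 0) := by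
        rw [← ENNReal.ofReal_zero]
        refine ENNReal.tendsto_ofReal ?_
        simpa only [one_div] using tendsto_one_div_add_atTop_nhds_zero_nat (𝕜 := ℝ)
      simpa using ENNReal.Tendsto.mul_const h1 (Or.inr hx.ne)
    simpa only [hwq] using hlim.eventually_lt_const one_pos
  refine ⟨fun n => bump (fun i => s n ^ 2 * c i) 0, fun n => ?_, fun n x => bump_mem_Icc x,
    fun n => ?_, fun k _ => ?_, ?_, fun k hk => ?_⟩
  · exact isTest_bump ha hc hsum (hs0 n) (hs1 n) 0
  · obtain ⟨K, hK, hsub⟩ := exists_isCompact_superset hc hct (R := 2 * ((n : ℝ) + 1)) (by positivity)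
    refine ⟨K, hK, fun y hy => hsub ?_⟩
    have h1 := wq_le_of_cutH_ne_zero hy
    rw [hwq, ENNReal.ofReal_inv_of_pos (by positivity), mul_comm, ← div_eq_mul_inv] at h1
    rw [mem_ofPred_eq, ENNReal.ofReal_mul two_pos.le, ENNReal.ofReal_ofNat]
    exact (ENNReal.div_le_iff_le_mul (Or.inl (by simp; positivity)) (Or.inl ENNReal.ofReal_ne_top)).1 h1
  · obtain ⟨K, hK⟩ := exists_iterD_bump_le hc
    have hlt' := tsum_ofReal_rpow_lt_top (fun i => mul_nonneg (ha i).le (hc0 i)) hsum hp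
    have hfin : ENNReal.ofReal (K k) ^ p * (∑' i, ENNReal.ofReal (a i * c i) ^ p) ^ k ≠ ∞ :=
      ENNReal.mul_ne_top (ENNReal.rpow_ne_top_of_nonneg (by linarith) ENNReal.ofReal_ne_top)
        (ENNReal.pow_ne_top hlt'.ne)
    refine ⟨_, fun n x => (derivSum_le_of_le ha hc0 (by linarith) fun l hl => ?_).trans_eq
      (ENNReal.coe_toNNReal hfin).symm⟩
    rw [← hl]
    exact hK (s n) (hs0 n) (hs1 n) 0 x l
  · filter_upwards [hae] with x hx
    refine tendsto_const_nhds.congr' ?_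
    filter_upwards [hx] with n hn using (bump_eq_one hn.le).symm
  · filter_upwards [hae] with x hx
    refine tendsto_const_nhds.congr' ?_
    filter_upwards [hx] with n hn
    have hw : ∀ i, 0 ≤ s n ^ 2 * c i := fun i => mul_nonneg (sq_nonneg _) (hc0 i)
    rw [derivSum_eq, eq_comm, lsum, ENNReal.tsum_eq_zero]
    intro I
    rw [iterD_bump_eq_zero hw hn (by
      intro h
      have := congrArg List.length h
      simp at this
      omega)]
    simp [(by linarith : 0 < p)]

/-! ### Multiplication in Sobolev spaces -/

section Sobolev

variable {a : ℕ → ℝ} {m : ℕ} {p : ℝ} {O : Set L2}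

/-- The weak derivatives of `f`, with `f` itself as the one of order zero. -/
noncomputable def wd (a : ℕ → ℝ) (p : ℝ) (O : Set L2) (f : L2 → ℝ) (l : List ℕ) : L2 → ℝ :=
  if l = [] then f else weakDeriv a p O l f

/-- The pointwise weighted sum of the `p`-th powers of all weak derivatives of order at most `m`. -/
noncomputable def wdSum (a : ℕ → ℝ) (m : ℕ) (p : ℝ) (O : Set L2) (f : L2 → ℝ) (x : L2) : ℝ≥0∞ :=
  ∑ k ∈ Finset.range (m + 1), lsum k fun l => lwt a p l * ‖wd a p O f l x‖ₑ ^ p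

/-- The pointwise weighted sum of the `p`-th powers of all derivatives of order at most `m`. -/
noncomputable def derivSums (a : ℕ → ℝ) (m : ℕ) (p : ℝ) (f : L2 → ℝ) (x : L2) : ℝ≥0∞ :=
  ∑ k ∈ Finset.range (m + 1), derivSum a p k f x

lemma MemW.isWeakDeriv_wd {f : L2 → ℝ} (hf : MemW a m p O f) {l : List ℕ} (hl : l.length ≤ m) :
    IsWeakDeriv a p O l f (wd a p O f l) := by
  by_cases h : l = []
  · subst h
    simpa [wd] using isWeakDeriv_nil hf.memLp
  · rw [wd, if_neg h]
    exact isWeakDeriv_weakDeriv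
      (hf.exists_weakDeriv l (List.length_pos_iff.2 h) hl)

lemma aemeasurable_lwt_mul {μ : Measure L2} {g : L2 → ℝ} (hg : AEStronglyMeasurable g μ)
    (l : List ℕ) : AEMeasurable (fun x => lwt a p l * ‖g x‖ₑ ^ p) μ :=
  (hg.enorm.pow_const p).const_mul _

lemma aemeasurable_lsum {μ : Measure L2} {k : ℕ} {g : List ℕ → L2 → ℝ}
    (hg : ∀ l : List ℕ, l.length = k → AEStronglyMeasurable (g l) μ) :
    AEMeasurable (fun x => lsum k fun l => lwt a p l * ‖g l x‖ₑ ^ p) μ :=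
  AEMeasurable.tsum fun I => aemeasurable_lwt_mul (hg _ (by simp)) _

lemma lintegral_lsum {μ : Measure L2} {k : ℕ} {g : List ℕ → L2 → ℝ}
    (hg : ∀ l : List ℕ, l.length = k → AEStronglyMeasurable (g l) μ) :
    ∫⁻ x, lsum k (fun l => lwt a p l * ‖g l x‖ₑ ^ p) ∂μ =
      lsum k fun l => lwt a p l * ∫⁻ x, ‖g l x‖ₑ ^ p ∂μ := by
  unfold lsum
  rw [lintegral_tsum fun I => aemeasurable_lwt_mul (hg _ (by simp)) _]
  exact tsum_congr fun I =>
    lintegral_const_mul'' _ ((hg _ (by simp)).enorm.pow_const p)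

lemma weakDerivSum_eq (f : L2 → ℝ) :
    ∫⁻ x in O, ‖f x‖ₑ ^ p ∂(P a) + weakDerivSum a m p O f =
      ∑ k ∈ Finset.range (m + 1),
        lsum k fun l => lwt a p l * ∫⁻ x in O, ‖wd a p O f l x‖ₑ ^ p ∂(P a) := by
  have hr : Finset.range (m + 1) = insert 0 (Finset.Icc 1 m) := by
    ext k; simp; omega
  rw [hr, Finset.sum_insert (by simp), lsum_zero, weakDerivSum]
  congr 1
  · simp [lwt, wd]
  · refine Finset.sum_congr rfl fun k hk => ?_
    rw [Finset.mem_Icc] at hk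
    simp only [← lwt_ofFn]
    rw [lsum]
    refine tsum_congr fun I => ?_
    rw [wd, if_neg]
    intro h
    have := congrArg List.length h
    simp at this
    omega

lemma MemW.lintegral_wdSum {f : L2 → ℝ} (hf : MemW a m p O f) :
    ∫⁻ x in O, wdSum a m p O f x ∂(P a) =
      ∫⁻ x in O, ‖f x‖ₑ ^ p ∂(P a) + weakDerivSum a m p O f := by
  rw [weakDerivSum_eq]
  unfold wdSum
  have hme : ∀ k ∈ Finset.range (m + 1), ∀ l : List ℕ, l.length = k →
      AEStronglyMeasurable (wd a p O f l) ((P a).restrict O) := fun k hk l hl =>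
    (hf.isWeakDeriv_wd (by rw [Finset.mem_range] at hk; omega)).1.1
  rw [lintegral_finsetSum' _ fun k hk => aemeasurable_lsum (hme k hk)]
  exact Finset.sum_congr rfl fun k hk => lintegral_lsum (hme k hk)

lemma MemW.aemeasurable_wdSum {f : L2 → ℝ} (hf : MemW a m p O f) :
    AEMeasurable (wdSum a m p O f) ((P a).restrict O) :=
  Finset.aemeasurable_fun_sum _ fun k hk => aemeasurable_lsum fun l hl =>
    (hf.isWeakDeriv_wd (by rw [Finset.mem_range] at hk; omega)).1.1

lemma MemW.lintegral_wdSum_ne_top (hp : 1 ≤ p) {f : L2 → ℝ} (hf : MemW a m p O f) :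
    ∫⁻ x in O, wdSum a m p O f x ∂(P a) ≠ ∞ := by
  rw [hf.lintegral_wdSum]
  refine ENNReal.add_ne_top.2 ⟨?_, hf.sum_lt_top.ne⟩
  have h := lintegral_rpow_enorm_lt_top_of_eLpNorm_lt_top
    (by simpa using (zero_lt_one.trans_le hp)) ENNReal.ofReal_ne_top hf.memLp.2
  rw [ENNReal.toReal_ofReal (by linarith)] at h
  exact h.ne

lemma measurable_iterD_of_multiplier {Y : L2 → ℝ} (hY : Multiplier a Y) (l : List ℕ) :
    Measurable (iterD l Y) :=
  (hY.fsmooth.meas l).comp (measurable_id.subtype_mk (h := fun x => mem_univ x))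

lemma measurable_derivSums {Y : L2 → ℝ} (hY : Multiplier a Y) : Measurable (derivSums a m p Y) := by
  refine Finset.measurable_fun_sum _ fun k _ => ?_
  refine Measurable.tsum fun I => ?_
  exact ((measurable_iterD_of_multiplier hY _).enorm.pow_const p).const_mul _

/-- Multiplication by `Y` in Sobolev spaces. The bound keeps the derivatives of `Y` under the
integral, so that it is also the source of the convergence result. -/
lemma exists_sobolev_mul_bound (ha : ∀ i, 0 < a i) (has : Summable a) (m : ℕ) (hp : 1 ≤ p)
    (hO : IsOpen O) : ∃ C : ℝ≥0, ∀ f, MemW a m p O f → ∀ Y, Multiplier a Y →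
      (∀ l, ∃ D : ℝ, ∀ x ∈ O, |iterD l Y x| ≤ D) →
      MemLp (fun x => Y x * f x) (ENNReal.ofReal p) ((P a).restrict O) ∧
      (∀ l : List ℕ, l.length ≤ m → ∃ g, IsWeakDeriv a p O l (fun x => Y x * f x) g) ∧
      ∫⁻ x in O, ‖Y x * f x‖ₑ ^ p ∂(P a) + weakDerivSum a m p O (fun x => Y x * f x) ≤
        C * ∫⁻ x in O, derivSums a m p Y x * wdSum a m p O f x ∂(P a) := by
  have hp0 : 0 < p := by linarith
  choose C hC using fun k => lsum_leibniz_le a hp0 k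
  refine ⟨∑ k ∈ Finset.range (m + 1), C k, fun f hf Y hY hYb => ?_⟩
  have hmul : MemLp (fun x => Y x * f x) (ENNReal.ofReal p) ((P a).restrict O) := by
    obtain ⟨D, hD⟩ := hYb []
    exact memLp_bounded_mul hO hf.memLp ((hY.fsmooth.mono (subset_univ O)).meas []) hD
  have hder : ∀ l : List ℕ, l.length ≤ m → IsWeakDeriv a p O l (fun x => Y x * f x)
      (fun x => ((splits l).map fun s => iterD s.1 Y x * wd a p O f s.2 x).sum) := fun l hl =>
    isWeakDeriv_mul ha hp hO hY hYb hf.memLp (wd a p O f) l fun s hs =>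
      hf.isWeakDeriv_wd (by have := length_add_of_mem_splits hs; omega)
  refine ⟨hmul, fun l hl => ⟨_, hder l hl⟩, ?_⟩
  have hae : ∀ l : List ℕ, l.length ≤ m → wd a p O (fun x => Y x * f x) l =ᵐ[(P a).restrict O]
      fun x => ((splits l).map fun s => iterD s.1 Y x * wd a p O f s.2 x).sum := by
    intro l hl
    by_cases h : l = []
    · subst h
      refine Eventually.of_forall fun x => ?_
      simp [wd, splits, iterD]
    · rw [wd, if_neg h]
      exact (isWeakDeriv_weakDeriv ⟨_, hder l hl⟩).ae_eq ha has hp hO (hder l hl)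
  rw [weakDerivSum_eq]
  push_cast
  rw [Finset.sum_mul]
  refine Finset.sum_le_sum fun k hk => ?_
  have hkm : k ≤ m := by rw [Finset.mem_range] at hk; omega
  have hsub : Finset.range (k + 1) ⊆ Finset.range (m + 1) := Finset.range_mono (by omega)
  calc lsum k (fun l => lwt a p l * ∫⁻ x in O, ‖wd a p O (fun x => Y x * f x) l x‖ₑ ^ p ∂(P a))
      = lsum k (fun l => lwt a p l * ∫⁻ x in O,
          ‖((splits l).map fun s => iterD s.1 Y x * wd a p O f s.2 x).sum‖ₑ ^ p ∂(P a)) := by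
        refine lsum_congr fun l hl => ?_
        congr 1
        refine lintegral_congr_ae ?_
        filter_upwards [hae l (hl.le.trans hkm)] with x hx
        rw [hx]
    _ = ∫⁻ x in O, lsum k (fun l => lwt a p l *
          ‖((splits l).map fun s => iterD s.1 Y x * wd a p O f s.2 x).sum‖ₑ ^ p) ∂(P a) :=
        (lintegral_lsum fun l hl => (hder l (hl.le.trans hkm)).1.1).symm
    _ ≤ ∫⁻ x in O, C k * (derivSums a m p Y x * wdSum a m p O f x) ∂(P a) := by
        refine lintegral_mono fun x => ?_
        refine (hC k _ (fun l => iterD l Y x) (fun l => wd a p O f l x) fun l _ => rfl).trans ?_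
        simp only [← derivSum_eq]
        exact mul_le_mul_right (mul_le_mul' (Finset.sum_le_sum_of_subset hsub)
          (Finset.sum_le_sum_of_subset hsub)) _
    _ = C k * ∫⁻ x in O, derivSums a m p Y x * wdSum a m p O f x ∂(P a) :=
        lintegral_const_mul' _ _ ENNReal.coe_ne_top

/-! ### Convergence of truncations -/

lemma derivSum_add_const {X : L2 → ℝ} (hX : Multiplier a X) (r : ℝ) {k : ℕ} (hk : 1 ≤ k) (x : L2) :
    derivSum a p k (fun x => X x + r) x = derivSum a p k X x := by
  rw [derivSum_eq, derivSum_eq]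
  refine lsum_congr fun l hl => ?_
  have hl' : l ≠ [] := by rintro rfl; simp at hl; omega
  rw [(hX.fsmooth.add_and_iterD_add isOpen_univ (fsmooth_const univ r)).2 l (mem_univ x),
    iterD_const hl']
  simp only [add_zero]

lemma derivSum_zero_eq (f : L2 → ℝ) (x : L2) : derivSum a p 0 f x = ‖f x‖ₑ ^ p := by
  rw [derivSum_eq, lsum_zero]
  simp [lwt, iterD]

lemma derivSums_add_const {X : L2 → ℝ} (hX : Multiplier a X) (r : ℝ) (x : L2) :
    derivSums a m p (fun x => X x + r) x =
      ‖X x + r‖ₑ ^ p + ∑ k ∈ Finset.range m, derivSum a p (k + 1) X x := by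
  rw [derivSums, Finset.sum_range_succ', derivSum_zero_eq, add_comm]
  congr 1
  exact Finset.sum_congr rfl fun k _ => derivSum_add_const hX r (by omega) x

variable {X : ℕ → L2 → ℝ}

lemma IsCompactlyTruncated.multiplier (ha : ∀ i, 0 < a i) (hX : IsCompactlyTruncated a p X)
    (r : ℝ) (n : ℕ) : Multiplier a fun x => X n x + r :=
  (multiplier_of_isTest ha (hX.isTest n)).add (multiplier_const ha r)

lemma IsCompactlyTruncated.exists_iterD_le (ha : ∀ i, 0 < a i) (hX : IsCompactlyTruncated a p X)
    (r : ℝ) (n : ℕ) (l : List ℕ) :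
    ∃ D : ℝ, ∀ x ∈ O, |iterD l (fun x => X n x + r) x| ≤ D := by
  obtain ⟨D, -, hD⟩ := (hX.isTest n).exists_abs_le ha isOpen_univ l
  refine ⟨D + |iterD l (fun _ => r) 0|, fun x _ => ?_⟩
  have hconst : iterD l (fun _ => r) x = iterD l (fun _ => r) 0 := by
    cases l with
    | nil => rfl
    | cons i l => rw [iterD_const (by simp)]
  have hadd := (((hX.isTest n).fsmooth ha isOpen_univ).add_and_iterD_add isOpen_univ
    (fsmooth_const univ r)).2 l (mem_univ x)
  simp only [hconst] at hadd
  rw [hadd]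
  exact (abs_add_le _ _).trans (add_le_add_left (hD x (mem_univ x)) _)

/-- The derivative sums of `X_n + r` are bounded uniformly in `n` for `|r| ≤ 1`. -/
lemma IsCompactlyTruncated.exists_derivSums_le (hp : 1 ≤ p) (ha : ∀ i, 0 < a i)
    (hX : IsCompactlyTruncated a p X) {r : ℝ} (hr : r ∈ Icc (-1 : ℝ) 0) (m : ℕ) :
    ∃ B : ℝ≥0, ∀ n x, derivSums a m p (fun x => X n x + r) x ≤ B := by
  choose C hC using fun k => hX.deriv_bound (k + 1) (by omega)
  refine ⟨1 + ∑ k ∈ Finset.range m, C k, fun n x => ?_⟩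
  rw [derivSums_add_const (multiplier_of_isTest ha (hX.isTest n))]
  push_cast
  refine add_le_add ?_ (Finset.sum_le_sum fun k _ => hC k n x)
  refine ENNReal.rpow_le_one ?_ (by linarith)
  rw [← ofReal_norm, ENNReal.ofReal_le_one, Real.norm_eq_abs, abs_le]
  have := hX.mem_Icc n x
  exact ⟨by linarith [this.1, hr.1], by linarith [this.2, hr.2]⟩

lemma IsCompactlyTruncated.ae_tendsto_derivSums (hp : 1 ≤ p) (ha : ∀ i, 0 < a i)
    (hX : IsCompactlyTruncated a p X) (m : ℕ) : ∀ᵐ x ∂(P a),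
      Tendsto (fun n => derivSums a m p (fun x => X n x + -1) x) atTop (𝓝 0) := by
  have hall := ae_all_iff.2 fun k : ℕ => hX.tendsto_deriv (k + 1) (by omega)
  filter_upwards [hX.tendsto_one, hall] with x h1 h2
  simp only [fun n => derivSums_add_const (m := m) (p := p)
    (multiplier_of_isTest ha (hX.isTest n)) (-1) x]
  have h3 : Tendsto (fun n => ‖X n x + -1‖ₑ ^ p) atTop (𝓝 0) := by
    have h4 : Tendsto (fun n => ‖X n x + -1‖ₑ) atTop (𝓝 0) := by
      have := (h1.add_const (-1)).enorm
      simpa using this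
    have := (ENNReal.continuous_rpow_const (y := p)).tendsto 0 |>.comp h4
    simpa [ENNReal.zero_rpow_of_pos (by linarith : 0 < p), Function.comp_def] using this
  have h5 := h3.add (tendsto_finsetSum (Finset.range m) fun k _ => h2 k)
  simpa using h5

lemma IsCompactlyTruncated.memW_mul (ha : ∀ i, 0 < a i) (has : Summable a) (hp : 1 ≤ p)
    (hO : IsOpen O) (hX : IsCompactlyTruncated a p X) {f : L2 → ℝ} (hf : MemW a m p O f) (n : ℕ) :
    MemW a m p O fun x => X n x * f x := by
  obtain ⟨C, hC⟩ := exists_sobolev_mul_bound ha has m hp hO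
  obtain ⟨B, hB⟩ := hX.exists_derivSums_le hp ha (r := 0) (by simp) m
  obtain ⟨h1, h2, h3⟩ := hC f hf _ (hX.multiplier ha 0 n) (hX.exists_iterD_le ha 0 n)
  simp only [add_zero] at h1 h2 h3 hB
  refine ⟨h1, fun l _ hl => h2 l hl, ?_⟩
  refine (le_add_self.trans h3).trans_lt ?_
  refine ENNReal.mul_lt_top ENNReal.coe_lt_top ?_
  calc ∫⁻ x in O, derivSums a m p (X n) x * wdSum a m p O f x ∂(P a)
      ≤ ∫⁻ x in O, B * wdSum a m p O f x ∂(P a) :=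
        lintegral_mono fun x => mul_le_mul_left (hB n x) _
    _ = B * ∫⁻ x in O, wdSum a m p O f x ∂(P a) := lintegral_const_mul' _ _ ENNReal.coe_ne_top
    _ < ∞ := ENNReal.mul_lt_top ENNReal.coe_lt_top (hf.lintegral_wdSum_ne_top hp).lt_top

lemma IsCompactlyTruncated.tendsto_normW (ha : ∀ i, 0 < a i) (has : Summable a) (hp : 1 ≤ p)
    (hO : IsOpen O) (hX : IsCompactlyTruncated a p X) {f : L2 → ℝ} (hf : MemW a m p O f) :
    Tendsto (fun n => normW a m p O fun x => X n x * f x - f x) atTop (𝓝 0) := by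
  obtain ⟨C, hC⟩ := exists_sobolev_mul_bound ha has m hp hO
  obtain ⟨B, hB⟩ := hX.exists_derivSums_le hp ha (r := -1) (by simp) m
  have hfin := hf.lintegral_wdSum_ne_top hp
  have hlim : Tendsto (fun n => ∫⁻ x in O,
      derivSums a m p (fun x => X n x + -1) x * wdSum a m p O f x ∂(P a)) atTop
      (𝓝 (∫⁻ _ in O, 0 ∂(P a))) := by
    refine tendsto_lintegral_of_dominated_convergence' (fun x => B * wdSum a m p O f x)
      (fun n => (measurable_derivSums (hX.multiplier ha _ n)).aemeasurable.mul
        hf.aemeasurable_wdSum)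
      (fun n => Eventually.of_forall fun x => mul_le_mul_left (hB n x) _) ?_ ?_
    · rw [lintegral_const_mul' _ _ ENNReal.coe_ne_top]
      exact ENNReal.mul_ne_top ENNReal.coe_ne_top hfin
    · filter_upwards [ae_restrict_of_ae (hX.ae_tendsto_derivSums hp ha m),
        ae_lt_top' hf.aemeasurable_wdSum hfin] with x hx hx'
      simpa using ENNReal.Tendsto.mul_const hx (Or.inr hx'.ne)
  rw [lintegral_zero] at hlim
  have hlim2 := ENNReal.Tendsto.const_mul (a := (C : ℝ≥0∞)) hlim (Or.inr ENNReal.coe_ne_top)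
  rw [mul_zero] at hlim2
  have hlim3 : Tendsto (fun n => ∫⁻ x in O, ‖(X n x + -1) * f x‖ₑ ^ p ∂(P a) +
      weakDerivSum a m p O fun x => (X n x + -1) * f x) atTop (𝓝 0) :=
    tendsto_of_tendsto_of_tendsto_of_le_of_le tendsto_const_nhds hlim2 (fun _ => zero_le)
      fun n => (hC f hf _ (hX.multiplier ha _ n) (hX.exists_iterD_le ha _ n)).2.2
  have hlim4 := (ENNReal.continuous_rpow_const (y := 1 / p)).tendsto 0 |>.comp hlim3
  rw [ENNReal.zero_rpow_of_pos (by positivity)] at hlim4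
  refine hlim4.congr fun n => ?_
  have : (fun x => X n x * f x - f x) = fun x => (X n x + -1) * f x := by ext x; ring
  rw [this]
  rfl

lemma supp_subset_of_isClosed (hp : 0 < p) (hO : IsOpen O) {f : L2 → ℝ} {K : Set L2}
    (hK : IsClosed K) (h : {x | f x ≠ 0} ⊆ K) : supp a p O f ⊆ K := by
  rintro x ⟨hxO, hx⟩
  by_contra hxK
  obtain ⟨r, hr, hball⟩ := Metric.isOpen_iff.1 (hO.inter hK.isOpen_compl) x ⟨hxO, hxK⟩
  refine hx (mem_sUnion_of_mem (Metric.mem_ball_self hr)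
    ⟨x, r, hr, rfl, hball.trans inter_subset_left, ?_⟩)
  rw [setLIntegral_congr_fun (g := fun _ => 0) Metric.isOpen_ball.measurableSet, lintegral_zero]
  intro y hy
  have : f y = 0 := by
    by_contra hne
    exact (hball hy).2 (h hne)
  simp [this, hp]

end Sobolev

end GaussSobolev

theorem mainTheorem7 (a : ℕ → ℝ) (ha : ∀ i, 0 < a i) (ha_summable : Summable a)
    (ha_lt : ∑' i, a i < 1) (m : ℕ) (hm : 1 ≤ m) (p : ℝ) (hp : 1 ≤ p)
    (O : Set GaussSobolev.L2) (hO : IsOpen O) (hO_ne : O.Nonempty) :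
    (∃ X : ℕ → GaussSobolev.L2 → ℝ, GaussSobolev.IsCompactlyTruncated a p X) ∧
    (∀ X : ℕ → GaussSobolev.L2 → ℝ, GaussSobolev.IsCompactlyTruncated a p X →
      ∀ f : GaussSobolev.L2 → ℝ, GaussSobolev.MemW a m p O f →
        (∀ k, GaussSobolev.MemW a m p O (fun x => X k x * f x)) ∧
        Tendsto (fun k => GaussSobolev.normW a m p O (fun x => X k x * f x - f x)) atTop (𝓝 0)) ∧
    (∀ f : GaussSobolev.L2 → ℝ, GaussSobolev.MemW a m p O f → ∀ ε : ℝ≥0∞, 0 < ε →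
      ∃ g : GaussSobolev.L2 → ℝ, GaussSobolev.MemW a m p O g ∧
        (∃ K : Set GaussSobolev.L2, IsCompact K ∧ GaussSobolev.supp a p O g ⊆ K) ∧
        GaussSobolev.normW a m p O (fun x => g x - f x) < ε) := by
  have hp0 : 0 < p := by linarith
  refine ⟨GaussSobolev.exists_isCompactlyTruncated ha ha_summable ha_lt hp,
    fun X hX f hf => ⟨hX.memW_mul ha ha_summable hp hO hf,
      hX.tendsto_normW ha ha_summable hp hO hf⟩, fun f hf ε hε => ?_⟩
  obtain ⟨X, hX⟩ := GaussSobolev.exists_isCompactlyTruncated ha ha_summable ha_lt hp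
  obtain ⟨n, hn⟩ := ((hX.tendsto_normW ha ha_summable hp hO hf).eventually_lt_const hε).exists
  obtain ⟨K, hK, hsub⟩ := hX.compact_support n
  refine ⟨fun x => X n x * f x, hX.memW_mul ha ha_summable hp hO hf n, ⟨K, hK, ?_⟩, hn⟩
  exact GaussSobolev.supp_subset_of_isClosed hp0 hO hK.isClosed
    fun x hx => hsub (left_ne_zero_of_mul hx)
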